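/- **Setting.** Let $\mathcal U$ be one of the categories $\mathbf{Set}$, $\mathbf{Top}$, $\mathbf{Haus}$, and $\mathcal T$ a class of test spaces, i.e. of (locally convex) subsets of Euclidean spaces with the $C^\infty$-maps between them (all derivatives exist and are continuous on the whole set). A *virtual object* $(X,I,O)$ is an object $X$ of $\mathcal U$ with families of input test maps $I(T)\subseteq\mathcal U(T,X)$ and output test maps $O(T)\subseteq\mathcal U(X,T)$, $T\in\mathcal T$, stable under composition with smooth maps between test spaces and such that $o\circ i$ is smooth for all $i\in I$, $o\in O$. A morphism is a $\mathcal U$-morphism $f$ with $f\circ I\subseteq I'$ and $O'\circ f\subseteq O$. On one $X$, write $(I,O)\le(I',O')$ if the identity is a morphism. Forcing conditions: * $\mathrm{Sat}$: a $\mathcal U$-morphism from (to) a test space belongs to $I$ (to $O$) if all its composites with $O$ (with $I$) are smooth; * $\mathrm{Sheaf}$: it belongs to the family if it does so locally (on the input side: on relatively open pieces of the test space that are again test spaces; on the output side, over $\mathbf{Top}$: near every point of $X$ it agrees with a member of $O$); * $\mathrm{Term}$: all $\mathcal U$-morphisms from (to) a terminal test space belong to the family; * input $\mathrm{Det}$: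 $i\colon T\to X$ is in $I$ if $i\circ t_\lambda\in I$ for all members of some family of smooth maps $t_\lambda\colon T_\lambda\to T$ that detects smoothness of $\mathcal U$-morphisms from $T$ to test spaces; output $\mathrm{Det}$: $o\colon X\to\mathbb R^n$ is in $O$ if its coordinates are. Write $(\mathcal U,\mathcal T,(\text{input condition},\text{output condition}))$ for the full subcategory of virtual objects satisfying the conditions, and $\mathbb R$, $\mathrm{Eucl}$, $\mathrm{Op}$, $\mathrm{Conv}$, $\mathrm{ClConv}$ for the test classes consisting of the real line only, of all Euclidean spaces, and of all open, all convex, all closed convex subsets of Euclidean spaces. Put * $\mathrm{Fr\ddot olicher}=(\mathbf{Set},\mathbb R,(\mathrm{Sat},\mathrm{Sat}))$, $\mathrm{Smith}=(\mathbf{Top},\mathbb R,(\mathrm{Sat},\mathrm{Sat}))$; * $\mathrm{Souriau}=(\mathbf{Set},\mathrm{Op},(\mathrm{Sheaf}\,\mathrm{Term},\mathrm{Sat}))$, $\mathrm{Chen}=(\mathbf{Set},\mathrm{Conv},(\mathrm{Sheaf}\,\mathrm{Term},\mathrm{Sat}))$; * $\mathrm{Sikorski}=(\mathbf{Top},\mathrm{Eucl},(\mathrm{Sat},\mathrm{Sheaf}\,\mathrm{Det}\,\mathrm{Term}))$;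 * $\mathrm{Chen}_{73}=(\mathbf{Haus},\mathrm{ClConv},(\mathrm{Term},\mathrm{Sat}))$, $\mathrm{Chen}_{75a}=(\mathbf{Top},\mathrm{ClConv},(\mathrm{Term},\mathrm{Sat}))$, $\mathrm{Chen}_{75b}=(\mathbf{Top},\mathrm{ClConv},(\mathrm{Det}\,\mathrm{Term},\mathrm{Sat}))$. For test classes $\mathcal S\subseteq\mathcal T$, restriction keeps the test maps for $\mathcal S$. On each $X$, the join extension of $V$ is the join of all structures whose restriction is $\le V$, and the meet extension is the meet of all structures whose restriction is $\ge V$ (joins and meets among the structures on $X$ that satisfy the conditions of the target category). When only the conditions change and $\mathcal T$ is fixed, these are the join and meet forcing functors. **Theorem.** 1. Restriction is an isomorphism of categories $(\mathbf{Set},\mathrm{Op},(\mathrm{Sat},\mathrm{Sat}))\cong\mathrm{Fr\ddot olicher}$, $(\mathbf{Top},\mathrm{Eucl},(\mathrm{Sat},\mathrm{Sat}))\cong\mathrm{Smith}$ and $\mathrm{Souriau}\cong(\mathbf{Set},\mathrm{Op}\cap\mathrm{Conv},(\mathrm{Sheaf}\,\mathrm{Term},\mathrm{Sat}))$; the inverse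 is extension, the join and the meet extension being equal. 2. Via 1, inclusion is a full embedding $\mathrm{Fr\ddot olicher}\to\mathrm{Souriau}$ with a left adjoint, given by the meet forcing functor. 3. Restriction to $\mathrm{Op}\cap\mathrm{Conv}$ followed by the inverse of the third isomorphism in 1 is a functor $\mathrm{Chen}\to\mathrm{Souriau}$ with both a left and a right adjoint; the left adjoint is given by the meet extension, the right adjoint by the join extension, and both adjoints are full embeddings $\mathrm{Souriau}\to\mathrm{Chen}$. 4. Via 1, inclusion is a full embedding $\mathrm{Smith}\to\mathrm{Sikorski}$ with a right adjoint, given by the join forcing functor. 5. Equipping a Frölicher space with the finest topology making its curves continuous, or with the coarsest topology making its functionals continuous, gives two full embeddings $\mathrm{Fr\ddot olicher}\to\mathrm{Smith}$. Both have as left inverse the functor $\mathrm{Smith}\to\mathrm{Fr\ddot olicher}$ which takes as curves all maps $c\colon\mathbb R\to X$, continuous or not, with $f\circ c$ smooth for all functionals $f$ of the Smith space, and as functionals all maps $X\to\mathbb R$ whose composites with these curves are smooth. 6. The inclusions $\mathrm{Chen}_{73}\to\mathrm{Chen}_{75a}$ and $\mathrm{Chen}_{75b}\to\mathrm{Chen}_{75a}$,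 and the join extension $\mathrm{Smith}\to\mathrm{Chen}_{75b}$, are full embeddings with left adjoints. -/

import Mathlib

open CategoryTheory
open scoped ContDiff

universe u

namespace SmoothSpaces

/-! ### Test spaces and smooth maps between them -/

/-- The Euclidean space `ℝⁿ`. -/
abbrev Euc (n : ℕ) : Type := EuclideanSpace ℝ (Fin n)

/-- A test space: a subset of some Euclidean space. -/
structure TestSpace where
  dim : ℕ
  carrier : Set (Euc dim)

instance : CoeSort TestSpace Type := ⟨fun S => S.carrier⟩

/-- Smooth maps between (locally convex) subsets of Euclidean spaces: on the source, all
derivatives exist and are continuous up to the boundary. -/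
def IsSmooth {S T : TestSpace} (f : S → T) : Prop :=
  ∃ g : Euc S.dim → Euc T.dim, ContDiffOn ℝ ∞ g S.carrier ∧ ∀ x : S, g x = f x

theorem IsSmooth.continuous {S T : TestSpace} {f : S → T} (hf : IsSmooth f) : Continuous f := by
  obtain ⟨g, hg, h⟩ := hf
  refine continuous_induced_rng.2 ?_
  have h1 : ((fun y : T => (y : Euc T.dim)) ∘ f) = S.carrier.domRestrict g := by
    funext x
    exact (h x).symm
  exact h1 ▸ continuousOn_iff_continuous_domRestrict.1 hg.continuousOn

theorem IsSmooth.comp {S T R : TestSpace} {g : T → R} {f : S → T} (hg : IsSmooth g)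
    (hf : IsSmooth f) : IsSmooth (g ∘ f) := by
  obtain ⟨g', hg, h⟩ := hg
  obtain ⟨f', hf, k⟩ := hf
  refine ⟨g' ∘ f', hg.comp hf fun x hx => ?_, fun x => ?_⟩
  · rw [k ⟨x, hx⟩]
    exact (f ⟨x, hx⟩).2
  · simp [k, h]

/-- The part of the test space `S` that lies in `U`. -/
def TestSpace.cut (S : TestSpace) (U : Set (Euc S.dim)) : TestSpace := ⟨S.dim, S.carrier ∩ U⟩

/-- The real line as a test space (as the one-dimensional Euclidean space). -/
def realLine : TestSpace := ⟨1, Set.univ⟩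

/-- The test category with the single object `ℝ`. -/
def lineTests : Set TestSpace := {realLine}

/-- All Euclidean spaces. -/
def euclideanTests : Set TestSpace := {S | S.carrier = Set.univ}

/-- All open subsets of Euclidean spaces. -/
def openTests : Set TestSpace := {S | IsOpen S.carrier}

/-- All convex subsets of Euclidean spaces. -/
def convexTests : Set TestSpace := {S | Convex ℝ S.carrier}

/-- All closed convex subsets of Euclidean spaces. -/
def closedConvexTests : Set TestSpace := {S | IsClosed S.carrier ∧ Convex ℝ S.carrier}

/-- `S` is a terminal object of the test category `𝒯`. -/
def IsTerminalTest (𝒯 : Set TestSpace) (S : TestSpace) : Prop :=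
  ∀ T ∈ 𝒯, ∃! f : T → S, IsSmooth f

/-- The coordinate projection `ℝⁿ → ℝ`, restricted to a test space. -/
noncomputable def coordinate (S : TestSpace) (j : Fin S.dim) (x : S) : realLine :=
  ⟨WithLp.toLp 2 (fun _ => (x : Euc S.dim) j), Set.mem_univ _⟩

/-! ### Underlying categories -/

/-- A category of sets with structure (below: sets, topological spaces, Hausdorff spaces) in
which every test space is an object; `inMor b S` and `outMor b S` are the morphisms from, and to,
the test space `S`, and `testMor S T` are the morphisms between two test spaces. -/
structure Underlying where
  Str : Type u → Type u
  mor : ∀ {X Y : Type u}, Str X → Str Y → Set (X → Y)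
  inMor : ∀ {X : Type u}, Str X → ∀ S : TestSpace, Set (S → X)
  outMor : ∀ {X : Type u}, Str X → ∀ S : TestSpace, Set (X → S)
  testMor : ∀ S T : TestSpace, Set (S → T)
  id_mor : ∀ {X : Type u} (b : Str X), id ∈ mor b b
  comp_mor : ∀ {X Y Z : Type u} {b : Str X} {c : Str Y} {d : Str Z} {f : X → Y} {g : Y → Z},
    f ∈ mor b c → g ∈ mor c d → g ∘ f ∈ mor b d

/-- Sets and all maps. -/
def sets : Underlying.{u} where
  Str _ := PUnit
  mor _ _ := Set.univ
  inMor _ _ := Set.univ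
  outMor _ _ := Set.univ
  testMor _ _ := Set.univ
  id_mor _ := trivial
  comp_mor _ _ := trivial

/-- Topological spaces and continuous maps. -/
def topologicalSpaces : Underlying.{u} where
  Str X := TopologicalSpace X
  mor b c := {f | @Continuous _ _ b c f}
  inMor b _ := {i | @Continuous _ _ _ b i}
  outMor b _ := {o | @Continuous _ _ b _ o}
  testMor _ _ := {f | Continuous f}
  id_mor b := @continuous_id _ b
  comp_mor {_ _ _ b c d _ _} hf hg := @Continuous.comp _ _ _ b c d _ _ hg hf

/-- Hausdorff topological spaces and continuous maps. -/
def hausdorffSpaces : Underlying.{u} where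
  Str X := {b : TopologicalSpace X // @T2Space X b}
  mor b c := {f | @Continuous _ _ b.1 c.1 f}
  inMor b _ := {i | @Continuous _ _ _ b.1 i}
  outMor b _ := {o | @Continuous _ _ b.1 _ o}
  testMor _ _ := {f | Continuous f}
  id_mor b := @continuous_id _ b.1
  comp_mor {_ _ _ b c d _ _} hf hg := @Continuous.comp _ _ _ b.1 c.1 d.1 _ _ hg hf

/-! ### Families of test maps -/

/-- Families of input test maps `S → X` and output test maps `X → S`, for `S` in the test category
`𝒯`, which are stable under composition with smooth maps between test spaces and compatible:
an input followed by an output is smooth. -/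
@[ext]
structure VirtualStr (B : Underlying.{u}) (𝒯 : Set TestSpace) {X : Type u} (b : B.Str X) where
  inp : ∀ S : 𝒯, Set (S.1 → X)
  out : ∀ S : 𝒯, Set (X → S.1)
  inp_mor : ∀ S, inp S ⊆ B.inMor b S.1
  out_mor : ∀ S, out S ⊆ B.outMor b S.1
  inp_comp : ∀ {S T : 𝒯} {f : S.1 → T.1} {i : T.1 → X}, IsSmooth f → i ∈ inp T → i ∘ f ∈ inp S
  out_comp : ∀ {S T : 𝒯} {f : S.1 → T.1} {o : X → S.1}, IsSmooth f → o ∈ out S → f ∘ o ∈ out T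
  compat : ∀ {S T : 𝒯} {i : S.1 → X} {o : X → T.1}, i ∈ inp S → o ∈ out T → IsSmooth (o ∘ i)

section

variable {B : Underlying.{u}} {𝒮 𝒯 : Set TestSpace}

/-- `V ≤ W` when the identity map is a morphism from `V` to `W`. -/
instance {X : Type u} (b : B.Str X) : PartialOrder (VirtualStr B 𝒯 b) where
  le V W := (∀ S, V.inp S ⊆ W.inp S) ∧ ∀ S, W.out S ⊆ V.out S
  le_refl V := ⟨fun _ => subset_rfl, fun _ => subset_rfl⟩
  le_trans _ _ _ h k := ⟨fun S => (h.1 S).trans (k.1 S), fun S => (k.2 S).trans (h.2 S)⟩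
  le_antisymm _ _ h k := VirtualStr.ext (funext fun S => (h.1 S).antisymm (k.1 S))
    (funext fun S => (k.2 S).antisymm (h.2 S))

/-- Restriction of both families of test maps to a smaller test category. -/
def VirtualStr.restrict (h : 𝒮 ⊆ 𝒯) {X : Type u} {b : B.Str X} (V : VirtualStr B 𝒯 b) :
    VirtualStr B 𝒮 b where
  inp S := V.inp ⟨S.1, h S.2⟩
  out S := V.out ⟨S.1, h S.2⟩
  inp_mor _ := V.inp_mor _
  out_mor _ := V.out_mor _
  inp_comp hf hi := V.inp_comp hf hi
  out_comp hf ho := V.out_comp hf ho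
  compat hi ho := V.compat hi ho

/-- `f` underlies a morphism: it is a morphism of the underlying category, it takes input test maps
to input test maps, and it pulls output test maps back to output test maps. -/
def IsMor {X Y : Type u} {b : B.Str X} {c : B.Str Y}
    (V : VirtualStr B 𝒯 b) (W : VirtualStr B 𝒯 c) (f : X → Y) : Prop :=
  f ∈ B.mor b c ∧ (∀ S, ∀ i ∈ V.inp S, f ∘ i ∈ W.inp S) ∧ ∀ S, ∀ o ∈ W.out S, o ∘ f ∈ V.out S

/-! ### Forcing conditions -/

/-- A condition on families of test maps; conditions are combined with `⊓`. -/
abbrev Condition (B : Underlying.{u}) (𝒯 : Set TestSpace) :=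
  ∀ ⦃X : Type u⦄ (b : B.Str X), VirtualStr B 𝒯 b → Prop

/-- Input saturation: a morphism from a test space is an input as soon as its composites with all
outputs are smooth. -/
def InSat : Condition B 𝒯 := fun X b V =>
  ∀ (S : 𝒯) (i : S.1 → X), i ∈ B.inMor b S.1 →
    (∀ T, ∀ o ∈ V.out T, IsSmooth (o ∘ i)) → i ∈ V.inp S

/-- Output saturation. -/
def OutSat : Condition B 𝒯 := fun X b V =>
  ∀ (T : 𝒯) (o : X → T.1), o ∈ B.outMor b T.1 →
    (∀ S, ∀ i ∈ V.inp S, IsSmooth (o ∘ i)) → o ∈ V.out T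

/-- The input sheaf condition: a morphism from a test space which is an input near every point
(on a relatively open subset that is again a test space) is an input. -/
def InSheaf : Condition B 𝒯 := fun X b V =>
  ∀ (S : 𝒯) (i : S.1 → X), i ∈ B.inMor b S.1 →
    (∀ x : S.1, ∃ U : Set (Euc S.1.dim), IsOpen U ∧ (x : Euc S.1.dim) ∈ U ∧
      ∃ h : S.1.cut U ∈ 𝒯, (fun y : S.1.cut U => i ⟨y.1, y.2.1⟩) ∈ V.inp ⟨S.1.cut U, h⟩) →
    i ∈ V.inp S

/-- The output sheaf condition, over topological spaces: a continuous map which agrees with an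
output near every point is an output. -/
def OutSheaf : Condition topologicalSpaces.{u} 𝒯 := fun X b V =>
  ∀ (T : 𝒯) (o : X → T.1), o ∈ topologicalSpaces.outMor b T.1 →
    (∀ x : X, ∃ U : Set X, @IsOpen X b U ∧ x ∈ U ∧ ∃ g ∈ V.out T, ∀ y ∈ U, o y = g y) →
    o ∈ V.out T

/-- The input terminal condition: all morphisms from a terminal test space are inputs. -/
def InTerm : Condition B 𝒯 := fun _ b V =>
  ∀ S : 𝒯, IsTerminalTest 𝒯 S.1 → B.inMor b S.1 ⊆ V.inp S

/-- The output terminal condition: all morphisms to a terminal test space are outputs. -/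
def OutTerm : Condition B 𝒯 := fun _ b V =>
  ∀ T : 𝒯, IsTerminalTest 𝒯 T.1 → B.outMor b T.1 ⊆ V.out T

/-- A family of smooth maps into the test space `S` is determining when a morphism from `S` to a
test space is smooth as soon as its composites with the members of the family are smooth. -/
def IsDetermining (B : Underlying.{u}) (𝒯 : Set TestSpace) (S : TestSpace)
    (F : ∀ T : 𝒯, Set (T.1 → S)) : Prop :=
  (∀ T, ∀ t ∈ F T, IsSmooth t) ∧
    ∀ (S' : 𝒯) (f : S → S'.1), f ∈ B.testMor S S'.1 →
      (∀ T, ∀ t ∈ F T, IsSmooth (f ∘ t)) → IsSmooth f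

/-- The input determined condition: a morphism from a test space is an input as soon as its
composites with the members of some determining family are inputs. -/
def InDet : Condition B 𝒯 := fun X b V =>
  ∀ (S : 𝒯) (F : ∀ T : 𝒯, Set (T.1 → S.1)), IsDetermining B 𝒯 S.1 F →
    ∀ i : S.1 → X, i ∈ B.inMor b S.1 → (∀ T, ∀ t ∈ F T, i ∘ t ∈ V.inp T) → i ∈ V.inp S

/-- The output specifically determined condition, for the families of coordinate projections: a
morphism to a test space is an output as soon as its coordinates are outputs. -/
def OutDetCoord (h : lineTests ⊆ 𝒯) : Condition B 𝒯 := fun X b V =>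
  ∀ (T : 𝒯) (o : X → T.1), o ∈ B.outMor b T.1 →
    (∀ j, coordinate T.1 j ∘ o ∈ V.out ⟨realLine, h (Set.mem_singleton _)⟩) → o ∈ V.out T

/-! ### Categories of smooth spaces -/

/-- An object of the underlying category with families of test maps satisfying the condition. -/
structure Space (P : Condition B 𝒯) where
  carrier : Type u
  base : B.Str carrier
  str : VirtualStr B 𝒯 base
  prop : P base str

@[ext]
structure Space.Hom {P : Condition B 𝒯} (A A' : Space P) where
  toFun : A.carrier → A'.carrier
  isMor : IsMor A.str A'.str toFun

instance (P : Condition B 𝒯) : Category (Space P) where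
  Hom := Space.Hom
  id A := ⟨id, B.id_mor _, fun _ _ h => h, fun _ _ h => h⟩
  comp f g := ⟨g.toFun ∘ f.toFun, B.comp_mor f.isMor.1 g.isMor.1,
    fun S _ hi => g.isMor.2.1 S _ (f.isMor.2.1 S _ hi),
    fun S _ ho => f.isMor.2.2 S _ (g.isMor.2.2 S _ ho)⟩

/-- A functor which only changes the test maps: it preserves the underlying objects and the
underlying maps of morphisms. -/
structure FibreFunctor (P : Condition B 𝒯) (Q : Condition B 𝒮) where
  obj : ∀ ⦃X : Type u⦄ (b : B.Str X), {V : VirtualStr B 𝒯 b // P b V} →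
    {W : VirtualStr B 𝒮 b // Q b W}
  map : ∀ ⦃X Y : Type u⦄ (b : B.Str X) (c : B.Str Y) (V : {V : VirtualStr B 𝒯 b // P b V})
    (W : {W : VirtualStr B 𝒯 c // P c W}) (f : X → Y),
    IsMor V.1 W.1 f → IsMor (obj b V).1 (obj c W).1 f

namespace FibreFunctor

variable {P : Condition B 𝒯} {Q : Condition B 𝒮}

def functor (F : FibreFunctor P Q) : Space P ⥤ Space Q where
  obj A := ⟨A.carrier, A.base, (F.obj A.base ⟨A.str, A.prop⟩).1, (F.obj A.base ⟨A.str, A.prop⟩).2⟩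
  map {A A'} f := ⟨f.toFun, F.map A.base A'.base ⟨A.str, A.prop⟩ ⟨A'.str, A'.prop⟩ _ f.isMor⟩
  map_id _ := rfl
  map_comp _ _ := rfl

/-- The functor restricts the test maps to the smaller test category. -/
def IsRestriction (F : FibreFunctor P Q) (h : 𝒮 ⊆ 𝒯) : Prop :=
  ∀ (X : Type u) (b : B.Str X) (V), (F.obj b V).1 = V.1.restrict h

/-- The functor takes `V` to the join of all structures whose restriction lies below `V`. -/
def IsJoinExtension (F : FibreFunctor P Q) (h : 𝒯 ⊆ 𝒮) : Prop :=
  ∀ (X : Type u) (b : B.Str X) (V),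
    IsLUB {W : {W : VirtualStr B 𝒮 b // Q b W} | W.1.restrict h ≤ V.1} (F.obj b V)

/-- The functor takes `V` to the meet of all structures whose restriction lies above `V`. -/
def IsMeetExtension (F : FibreFunctor P Q) (h : 𝒯 ⊆ 𝒮) : Prop :=
  ∀ (X : Type u) (b : B.Str X) (V),
    IsGLB {W : {W : VirtualStr B 𝒮 b // Q b W} | V.1 ≤ W.1.restrict h} (F.obj b V)

/-- The functor is the inclusion between two full subcategories defined by conditions. -/
def IsInclusion {Q : Condition B 𝒯} (F : FibreFunctor P Q) : Prop :=
  ∀ (X : Type u) (b : B.Str X) (V), (F.obj b V).1 = V.1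

/-- The forcing functor which takes `V` to the join of all structures below `V`. -/
def IsJoinForcing {Q : Condition B 𝒯} (F : FibreFunctor P Q) : Prop :=
  ∀ (X : Type u) (b : B.Str X) (V),
    IsLUB {W : {W : VirtualStr B 𝒯 b // Q b W} | W.1 ≤ V.1} (F.obj b V)

/-- The forcing functor which takes `V` to the meet of all structures above `V`. -/
def IsMeetForcing {Q : Condition B 𝒯} (F : FibreFunctor P Q) : Prop :=
  ∀ (X : Type u) (b : B.Str X) (V),
    IsGLB {W : {W : VirtualStr B 𝒯 b // Q b W} | V.1 ≤ W.1} (F.obj b V)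

/-- The functors are mutually inverse, and the second is both the join and the meet extension
along the restriction functor given by the first. -/
def IsRestrictionExtensionIso (R : FibreFunctor P Q) (E : FibreFunctor Q P) (h : 𝒮 ⊆ 𝒯) : Prop :=
  R.IsRestriction h ∧ E.IsJoinExtension h ∧ E.IsMeetExtension h ∧
    R.functor ⋙ E.functor = 𝟭 (Space P) ∧ E.functor ⋙ R.functor = 𝟭 (Space Q)

end FibreFunctor

end

theorem line_subset_open : lineTests ⊆ openTests := by
  rintro _ rfl; exact (isOpen_univ : IsOpen (Set.univ : Set (Euc 1)))

theorem line_subset_euclidean : lineTests ⊆ euclideanTests := by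
  rintro _ rfl; rfl

theorem line_subset_closedConvex : lineTests ⊆ closedConvexTests := by
  rintro _ rfl; exact ⟨isClosed_univ, convex_univ⟩

/-- Frölicher spaces `(X, C, F)`. -/
def frolicher : Condition sets.{u} lineTests := InSat ⊓ OutSat

/-- The variant of Frölicher spaces with all open subsets of Euclidean spaces as test spaces. -/
def frolicherOpen : Condition sets.{u} openTests := InSat ⊓ OutSat

/-- Souriau (diffeological) spaces. -/
def souriau : Condition sets.{u} openTests := InSheaf ⊓ InTerm ⊓ OutSat

/-- The variant of Souriau spaces with only the open convex sets as test spaces. -/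
def souriauConvex : Condition sets.{u} (openTests ∩ convexTests) := InSheaf ⊓ InTerm ⊓ OutSat

/-- Chen spaces (final definition). -/
def chen : Condition sets.{u} convexTests := InSheaf ⊓ InTerm ⊓ OutSat

/-- Smith spaces. -/
def smith : Condition topologicalSpaces.{u} lineTests := InSat ⊓ OutSat

/-- The variant of Smith spaces with all Euclidean spaces as test spaces. -/
def smithEuclidean : Condition topologicalSpaces.{u} euclideanTests := InSat ⊓ OutSat

/-- Sikorski spaces. -/
def sikorski : Condition topologicalSpaces.{u} euclideanTests :=
  InSat ⊓ (OutSheaf ⊓ OutDetCoord line_subset_euclidean ⊓ OutTerm)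

/-- Chen spaces, first definition (1973). -/
def chen1973 : Condition hausdorffSpaces.{u} closedConvexTests := InTerm ⊓ OutSat

/-- Chen spaces, second definition (1975). -/
def chen1975a : Condition topologicalSpaces.{u} closedConvexTests := InTerm ⊓ OutSat

/-- Chen spaces, third definition (1975). -/
def chen1975b : Condition topologicalSpaces.{u} closedConvexTests := InDet ⊓ InTerm ⊓ OutSat

/-! ### Functors which change the underlying category -/

/-- The inclusion of Hausdorff spaces in topological spaces, on the level of Chen spaces. -/
def chen1973Inclusion : Space chen1973.{u} ⥤ Space chen1975a.{u} where
  obj A := {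
    carrier := A.carrier
    base := A.base.1
    str := {
      inp := A.str.inp
      out := A.str.out
      inp_mor := A.str.inp_mor
      out_mor := A.str.out_mor
      inp_comp := A.str.inp_comp
      out_comp := A.str.out_comp
      compat := A.str.compat }
    prop := A.prop }
  map f := ⟨f.toFun, f.isMor⟩

/-- A Frölicher space with a topology for which its curves and functionals are continuous is a
Smith space. -/
def Frolicher.withTopology (A : Space frolicher.{u}) (t : TopologicalSpace A.carrier)
    (hi : ∀ S, ∀ i ∈ A.str.inp S, @Continuous _ _ _ t i)
    (ho : ∀ S, ∀ o ∈ A.str.out S, @Continuous _ _ t _ o) : Space smith.{u} where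
  carrier := A.carrier
  base := t
  str := {
    inp := A.str.inp
    out := A.str.out
    inp_mor := hi
    out_mor := ho
    inp_comp := A.str.inp_comp
    out_comp := A.str.out_comp
    compat := A.str.compat }
  prop := ⟨fun S i _ h => A.prop.1 S i trivial h, fun T o _ h => A.prop.2 T o trivial h⟩

/-- The finest topology for which all smooth curves are continuous. -/
abbrev Frolicher.curvaceous (A : Space frolicher.{u}) : TopologicalSpace A.carrier :=
  ⨆ (S : lineTests) (i : A.str.inp S), TopologicalSpace.coinduced i.1 inferInstance

/-- The coarsest topology for which all smooth functionals are continuous. -/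
abbrev Frolicher.functional (A : Space frolicher.{u}) : TopologicalSpace A.carrier :=
  ⨅ (S : lineTests) (o : A.str.out S), TopologicalSpace.induced o.1 inferInstance

/-- Frölicher spaces as Smith spaces, with the curvaceous topology. -/
def frolicherToSmithCurvaceous : Space frolicher.{u} ⥤ Space smith.{u} where
  obj A := Frolicher.withTopology A (Frolicher.curvaceous A)
    (fun S i hi => continuous_iff_coinduced_le.2
      (le_iSup₂_of_le (f := fun (S : lineTests) (i : A.str.inp S) =>
        TopologicalSpace.coinduced i.1 inferInstance) S ⟨i, hi⟩ le_rfl))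
    (fun _ _ ho => continuous_iSup_dom.2 fun _ => continuous_iSup_dom.2 fun i =>
      continuous_coinduced_dom.2 (A.str.compat i.2 ho).continuous)
  map {A A'} f := ⟨f.toFun,
    continuous_iSup_dom.2 fun S => continuous_iSup_dom.2 fun i => continuous_coinduced_dom.2
      (continuous_iff_coinduced_le.2
        (le_iSup₂_of_le (f := fun (S : lineTests) (i : A'.str.inp S) =>
          TopologicalSpace.coinduced i.1 inferInstance) S ⟨_, f.isMor.2.1 S i.1 i.2⟩ le_rfl)),
    f.isMor.2⟩

/-- Frölicher spaces as Smith spaces, with the functional topology. -/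
def frolicherToSmithFunctional : Space frolicher.{u} ⥤ Space smith.{u} where
  obj A := Frolicher.withTopology A (Frolicher.functional A)
    (fun _ _ hi => continuous_iInf_rng.2 fun _ => continuous_iInf_rng.2 fun o =>
      continuous_induced_rng.2 (A.str.compat hi o.2).continuous)
    (fun S o ho => continuous_iff_le_induced.2
      (iInf₂_le_of_le (f := fun (S : lineTests) (o : A.str.out S) =>
        TopologicalSpace.induced o.1 inferInstance) S ⟨o, ho⟩ le_rfl))
  map {A A'} f := ⟨f.toFun,
    continuous_iInf_rng.2 fun S => continuous_iInf_rng.2 fun o => continuous_induced_rng.2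
      (continuous_iff_le_induced.2
        (iInf₂_le_of_le (f := fun (S : lineTests) (o : A.str.out S) =>
          TopologicalSpace.induced o.1 inferInstance) S ⟨_, f.isMor.2.2 S o.1 o.2⟩ le_rfl)),
    f.isMor.2⟩

/-- The Frölicher space of a Smith space: its curves are all (not necessarily continuous) maps
whose composites with the functionals of the Smith space are smooth, and its functionals are all
maps whose composites with these curves are smooth. -/
def smithToFrolicher : Space smith.{u} ⥤ Space frolicher.{u} where
  obj A := {
    carrier := A.carrier
    base := PUnit.unit
    str := {
      inp := fun S => {i | ∀ T, ∀ o ∈ A.str.out T, IsSmooth (o ∘ i)}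
      out := fun T => {o | ∀ (S : lineTests) (i : S.1 → A.carrier),
        (∀ T', ∀ o' ∈ A.str.out T', IsSmooth (o' ∘ i)) → IsSmooth (o ∘ i)}
      inp_mor := fun _ _ _ => trivial
      out_mor := fun _ _ _ => trivial
      inp_comp := fun hf hi T o ho => (hi T o ho).comp hf
      out_comp := fun hf ho S i hi => hf.comp (ho S i hi)
      compat := fun hi ho => ho _ _ hi }
    prop := ⟨fun _ _ _ h T o ho => h T o fun _ _ hi => hi T o ho, fun _ _ _ h => h⟩ }
  map f := ⟨f.toFun, trivial, fun _ _ hi T o ho => hi T _ (f.isMor.2.2 T o ho),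
    fun _ _ ho S i hi => ho S _ fun T o' ho' => hi T _ (f.isMor.2.2 T o' ho')⟩

end SmoothSpaces

open SmoothSpaces

/-! The analytic core is that smooth curves detect smoothness: a map on an open or convex subset of
`ℝⁿ` is smooth, up to the boundary in the convex case, as soon as its composites with all smooth
curves in the set are smooth (`CurveDetermined`).

On all of `ℝⁿ` this is Boman's theorem. A smooth curve can be drawn through any sufficiently fast
converging sequence, even with prescribed small velocities (`exists_curve_through`). Such curves
show that a function smooth along curves is continuous and that its iterated directional derivatives
are locally bounded. After a cutoff these derivatives are integrable, so the Fourier transform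
decays faster than any power and Fourier inversion yields smoothness. On a convex set, Boman's
theorem gives smoothness in the interior. The first derivative at a boundary point is read off from
the second derivative of a curve leaving that point with velocity zero; it is again smooth along
curves, so induction on the order applies (`SmoothAlongCurves.contDiffOn`).

The rest is order theory on the structures over a fixed object. Every functor there keeps the
underlying maps, so units and counits are identity maps and an adjunction amounts to inequalities
(`FibreFunctor.adjunction`). Structures saturated on both sides are determined by curves and
functionals (`lineExtensionFunctor_iso`), and dropping to them means saturating one family. From
open convex test spaces there is a largest extension (`probeExtension`) and a smallest one
(`germExtension`). They give the two adjoints for Chen spaces; for open test spaces the largest is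
also the smallest.

For the early Chen spaces, the left adjoints are the Hausdorff quotient, the hull under determined
inputs, and restriction to the line followed by saturation of the curves. -/

namespace SmoothSpaces

/-! ### Smooth curves through fast converging sequences, and their first consequences. -/

section

open Filter Topology Metric

/-- The centres of the bumps used to build curves through fast converging sequences. -/
noncomputable def bumpCentre (k : ℕ) : ℝ := (1 / 2) ^ k

theorem bumpCentre_pos (k : ℕ) : 0 < bumpCentre k := by
  unfold bumpCentre; positivity

theorem tendsto_bumpCentre : Tendsto bumpCentre atTop (𝓝 0) :=
  tendsto_pow_atTop_nhds_zero_of_lt_one (by norm_num) (by norm_num)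

/-- Bumps around the points `2⁻ᵏ` with disjoint supports. -/
noncomputable def separatedBump (k : ℕ) : ContDiffBump (bumpCentre k) where
  rIn := bumpCentre k / 8
  rOut := bumpCentre k / 4
  rIn_pos := by have := bumpCentre_pos k; positivity
  rIn_lt_rOut := by have := bumpCentre_pos k; linarith

theorem bumpCentre_le_half {j k : ℕ} (h : j < k) : bumpCentre k ≤ bumpCentre j / 2 := by
  have : bumpCentre k ≤ bumpCentre (j + 1) :=
    pow_le_pow_of_le_one (by norm_num) (by norm_num) h
  refine this.trans_eq ?_
  simp only [bumpCentre, pow_succ]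
  ring

theorem bumpCentre_mem_of_ne_zero {k : ℕ} {t : ℝ} (h : separatedBump k t ≠ 0) :
    3 / 4 * bumpCentre k < t ∧ t < 5 / 4 * bumpCentre k := by
  have h1 : t ∈ Function.support (separatedBump k) := h
  rw [ContDiffBump.support_eq, mem_ball, Real.dist_eq, abs_lt] at h1
  simp only [separatedBump] at h1
  constructor <;> linarith [h1.1, h1.2]

/-- The `k`-th support lies between `3/4` and `5/4` of `2⁻ᵏ`. Passing to a later bump at least
halves the centre, and `5/8 < 3/4`. -/
theorem separatedBump_eq_zero {j k : ℕ} (h : j ≠ k) {t : ℝ} (hk : separatedBump k t ≠ 0) :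
    separatedBump j t = 0 := by
  by_contra hj
  have h1 := bumpCentre_mem_of_ne_zero hk
  have h2 := bumpCentre_mem_of_ne_zero hj
  have := bumpCentre_pos k
  have := bumpCentre_pos j
  rcases lt_or_gt_of_ne h with h | h
  · have := bumpCentre_le_half h; linarith [h1.1, h1.2, h2.1, h2.2]
  · have := bumpCentre_le_half h; linarith [h1.1, h1.2, h2.1, h2.2]

theorem separatedBump_zero (k : ℕ) : separatedBump k 0 = 0 := by
  by_contra h
  have h1 := bumpCentre_mem_of_ne_zero h
  linarith [bumpCentre_pos k, h1.1]

theorem exists_iteratedFDeriv_bound {φ : ℝ → ℝ} (hφ : ContDiff ℝ ∞ φ) (h : HasCompactSupport φ)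
    (k : ℕ) : ∃ M > 0, ∀ i ≤ k, ∀ t, ‖iteratedFDeriv ℝ i φ t‖ ≤ M := by
  have h1 (i : ℕ) : ∃ C, ∀ t, ‖iteratedFDeriv ℝ i φ t‖ ≤ C :=
    (hφ.continuous_iteratedFDeriv (mod_cast le_top)).bounded_above_of_compact_support
      (h.iteratedFDeriv i)
  choose C hC using h1
  have hC0 (i : ℕ) : 0 ≤ C i := (norm_nonneg _).trans (hC i 0)
  refine ⟨1 + ∑ i ∈ Finset.range (k + 1), C i, ?_, fun i hi t => (hC i t).trans ?_⟩
  · have := Finset.sum_nonneg fun i (_ : i ∈ Finset.range (k + 1)) => hC0 i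
    linarith
  · have := Finset.single_le_sum (fun i (_ : i ∈ Finset.range (k + 1)) => hC0 i)
      (Finset.mem_range.2 (Nat.lt_succ_of_le hi))
    linarith

theorem norm_iteratedFDeriv_smul_const_le {E : Type*} [NormedAddCommGroup E] [NormedSpace ℝ E]
    {φ : ℝ → ℝ} (hφ : ContDiff ℝ ∞ φ) (a : E) (i : ℕ) (t : ℝ) :
    ‖iteratedFDeriv ℝ i (fun s => φ s • a) t‖ ≤ ‖a‖ * ‖iteratedFDeriv ℝ i φ t‖ := by
  have := (ContinuousLinearMap.toSpanSingleton ℝ a).norm_iteratedFDeriv_comp_left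
    (hφ.contDiffAt (x := t)) (n := i) (mod_cast le_top)
  rwa [ContinuousLinearMap.norm_toSpanSingleton] at this

/-- Curves through fast converging sequences, with prescribed small velocities. -/
theorem exists_curve_through : ∃ δ : ℕ → ℝ, (∀ k, 0 < δ k) ∧
    ∀ {E : Type} [NormedAddCommGroup E] [NormedSpace ℝ E] [CompleteSpace E] (a b : ℕ → E),
      (∀ k, ‖a k‖ ≤ δ k) → (∀ k, ‖b k‖ ≤ δ k) →
      ∃ c : ℝ → E, ContDiff ℝ ∞ c ∧ c 0 = 0 ∧
        (∀ k, ∀ᶠ s in 𝓝 (0 : ℝ), c (bumpCentre k + s) = a k + s • b k) ∧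
        ((∀ k, b k = 0) → ∀ t, ∃ k, c t ∈ segment ℝ 0 (a k)) := by
  have h1 (k : ℕ) := exists_iteratedFDeriv_bound (separatedBump k).contDiff
    (separatedBump k).hasCompactSupport k
  have hχ (k : ℕ) : ContDiff ℝ ∞ (fun t => separatedBump k t * (t - bumpCentre k)) :=
    (separatedBump k).contDiff.mul (contDiff_id.sub contDiff_const)
  have h2 (k : ℕ) := exists_iteratedFDeriv_bound (hχ k)
    ((separatedBump k).hasCompactSupport.mul_right) k
  choose M hM0 hM using h1
  choose N hN0 hN using h2
  -- `M k` and `N k` bound the derivatives up to order `k` of the `k`-th bump and of its product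
  -- with `t - 2⁻ᵏ`. This choice makes the `i`-th derivative of the `k`-th summand at most `2⁻ᵏ`
  -- once `k ≥ i`, and it depends neither on `E` nor on the sequences.
  refine ⟨fun k => (1 / 2) ^ k / (M k + N k), fun k => ?_, fun {E} _ _ _ a b ha hb => ?_⟩
  · have := hM0 k; have := hN0 k; positivity
  let g : ℕ → ℝ → E := fun k t => separatedBump k t • a k +
    (separatedBump k t * (t - bumpCentre k)) • b k
  have hg (k : ℕ) : ContDiff ℝ ∞ (g k) :=
    ((separatedBump k).contDiff.smul contDiff_const).add ((hχ k).smul contDiff_const)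
  have hone {k : ℕ} {t : ℝ} (h : separatedBump k t ≠ 0) : ∑' j, g j t = g k t := by
    refine tsum_eq_single k fun j hj => ?_
    simp [g, separatedBump_eq_zero hj h]
  refine ⟨fun t => ∑' k, g k t, ?_, ?_, fun k => ?_, fun hb0 t => ?_⟩
  · refine contDiff_tsum_of_eventually (N := ⊤) (v := fun _ k => (1 / 2) ^ k) hg
      (fun i _ => summable_geometric_of_lt_one (by norm_num) (by norm_num)) fun i _ => ?_
    rw [Nat.cofinite_eq_atTop]
    filter_upwards [eventually_ge_atTop i] with k hk t
    have e1 := norm_iteratedFDeriv_smul_const_le (separatedBump k).contDiff (a k) i t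
    have e2 := norm_iteratedFDeriv_smul_const_le (hχ k) (b k) i t
    have hp : 0 < M k + N k := add_pos (hM0 k) (hN0 k)
    have hd : 0 ≤ (1 / 2 : ℝ) ^ k / (M k + N k) := by positivity
    have e3 : iteratedFDeriv ℝ i (g k) t = iteratedFDeriv ℝ i (fun s => separatedBump k s • a k) t
        + iteratedFDeriv ℝ i (fun s => (separatedBump k s * (s - bumpCentre k)) • b k) t :=
      iteratedFDeriv_add_apply
        ((((separatedBump k).contDiff (n := ⊤)).smul contDiff_const).contDiffAt.of_le
          (mod_cast le_top))
        (((hχ k).smul contDiff_const).contDiffAt.of_le (mod_cast le_top))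
    rw [e3]
    calc _ ≤ ‖a k‖ * ‖iteratedFDeriv ℝ i (separatedBump k) t‖ + ‖b k‖ *
          ‖iteratedFDeriv ℝ i (fun t => separatedBump k t * (t - bumpCentre k)) t‖ :=
          (norm_add_le _ _).trans (add_le_add e1 e2)
      _ ≤ (1 / 2) ^ k / (M k + N k) * M k + (1 / 2) ^ k / (M k + N k) * N k := by
          gcongr
          · exact ha k
          · exact hM k i hk t
          · exact hb k
          · exact hN k i hk t
      _ = (1 / 2) ^ k := by field_simp
  · simp [g, separatedBump_zero]
  -- The bump is 1 on a whole neighbourhood of its centre, so the curve is affine there and all its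
  -- derivatives are known.
  · have : ∀ᶠ s in 𝓝 (0 : ℝ), separatedBump k (bumpCentre k + s) = 1 := by
      have h : Tendsto (fun s : ℝ => bumpCentre k + s) (𝓝 0) (𝓝 (bumpCentre k)) := by
        simpa using (continuous_const_add (bumpCentre k)).tendsto (0 : ℝ)
      exact h.eventually (separatedBump k).eventuallyEq_one
    filter_upwards [this] with s hs
    have h0 : separatedBump k (bumpCentre k + s) ≠ 0 := by rw [hs]; exact one_ne_zero
    simp [hone h0, g, hs]
  · by_cases h : ∃ k, separatedBump k t ≠ 0
    · obtain ⟨k, hk⟩ := h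
      refine ⟨k, ?_⟩
      beta_reduce
      rw [hone hk]
      simp only [g, hb0, smul_zero, add_zero]
      exact ⟨1 - separatedBump k t, separatedBump k t, by linarith [(separatedBump k).le_one (x := t)],
        (separatedBump k).nonneg, by ring, by simp⟩
    · push Not at h
      -- Outside all supports the curve is at the origin, an end point of every segment; any index
      -- would do.
      refine ⟨0, ?_⟩
      simp only [g, h, zero_smul, zero_mul, add_zero, tsum_zero]
      exact left_mem_segment _ _ _

/-- `f` is smooth along all smooth curves in `K`. -/
def SmoothAlongCurves {E : Type*} [NormedAddCommGroup E] [NormedSpace ℝ E] {F : Type*}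
    [NormedAddCommGroup F] [NormedSpace ℝ F] (K : Set E) (f : E → F) : Prop :=
  ∀ c : ℝ → E, ContDiff ℝ ∞ c → (∀ t, c t ∈ K) → ContDiff ℝ ∞ (f ∘ c)

/-- A discontinuity at `x` yields points within `δ k` of `x` whose values stay away from `f x`. One
smooth curve runs through all of them into `x`; it lies on segments from `x` to these points, so
convexity keeps it in `K`. -/
theorem SmoothAlongCurves.continuousOn {E : Type} [NormedAddCommGroup E] [NormedSpace ℝ E]
    [CompleteSpace E] {F : Type*} [NormedAddCommGroup F] [NormedSpace ℝ F] {K : Set E} {f : E → F}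
    (hf : SmoothAlongCurves K f) (hK : Convex ℝ K) : ContinuousOn f K := by
  obtain ⟨δ, hδ, H⟩ := exists_curve_through
  intro x hx
  by_contra hcon
  rw [Metric.continuousWithinAt_iff] at hcon
  push Not at hcon
  obtain ⟨ε, hε, h⟩ := hcon
  choose y hy hyδ hyε using fun k => h (δ k) (hδ k)
  obtain ⟨c, hc, hc0, hck, hcs⟩ := H (fun k => y k - x) (fun _ => 0)
    (fun k => by rw [← dist_eq_norm]; exact (hyδ k).le) (fun k => by simpa using (hδ k).le)
  have hcK (t : ℝ) : x + c t ∈ K := by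
    obtain ⟨k, hk⟩ := hcs (fun _ => rfl) t
    refine hK.segment_subset hx (hy k) ?_
    have := (mem_segment_translate ℝ x).2 hk
    simpa using this
  have h1 := (hf (fun t => x + c t) (contDiff_const.add hc) hcK).continuous
  have h2 : Tendsto (fun k => f (x + c (bumpCentre k))) atTop (𝓝 (f (x + c 0))) :=
    (h1.tendsto 0).comp tendsto_bumpCentre
  have h3 (k : ℕ) : x + c (bumpCentre k) = y k := by
    have := (hck k).self_of_nhds
    simp only [add_zero, smul_zero] at this
    simp [this]
  simp only [h3, hc0, add_zero] at h2
  obtain ⟨k, hk⟩ := ((Metric.tendsto_nhds.1 h2) ε hε).exists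
  exact absurd hk (not_lt.2 (hyε k))

/-- The `p`-th derivative of `f` at `x` in the direction `v`. -/
noncomputable def lineIter {E : Type*} [NormedAddCommGroup E] [NormedSpace ℝ E] {F : Type*}
    [NormedAddCommGroup F] [NormedSpace ℝ F] (f : E → F) (v : E) (p : ℕ) (x : E) : F :=
  iteratedDeriv p (fun t : ℝ => f (x + t • v)) 0

section

variable {E : Type} [NormedAddCommGroup E] [NormedSpace ℝ E] {F : Type*} [NormedAddCommGroup F]
  [NormedSpace ℝ F] {f : E → F}

theorem SmoothAlongCurves.line (hf : SmoothAlongCurves Set.univ f) (x v : E) :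
    ContDiff ℝ ∞ (fun t : ℝ => f (x + t • v)) :=
  hf (fun t : ℝ => x + t • v) (contDiff_const.add (contDiff_id.smul contDiff_const))
    fun _ => Set.mem_univ _

theorem lineIter_zero (v x : E) : lineIter f v 0 x = f x := by
  simp [lineIter]

theorem lineIter_add_smul (v x : E) (p : ℕ) (t : ℝ) :
    lineIter f v p (x + t • v) = iteratedDeriv p (fun s : ℝ => f (x + s • v)) t := by
  have h := congrFun (iteratedDeriv_comp_const_add p (fun s : ℝ => f (x + s • v)) t) 0
  simp only [add_zero] at h
  rw [← h, lineIter]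
  congr 1
  funext s
  rw [add_smul, add_assoc]

theorem SmoothAlongCurves.hasLineDerivAt (hf : SmoothAlongCurves Set.univ f) (v x : E) (p : ℕ) :
    HasLineDerivAt ℝ (lineIter f v p) (lineIter f v (p + 1) x) x v := by
  unfold HasLineDerivAt
  simp only [lineIter_add_smul]
  have h := ((hf.line x v).differentiable_iteratedDeriv p (mod_cast WithTop.coe_lt_top _)) 0
  have h2 := h.hasDerivAt
  rwa [← iteratedDeriv_succ] at h2

/-- Otherwise there are points `y k` converging fast to `x` at which the `p`-th derivative exceeds
`k / l k ^ p`. A smooth curve passing `y k` with velocity `l k • v` has `p`-th derivative larger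
than `k` there, although this derivative is continuous at time 0. -/
theorem SmoothAlongCurves.exists_bound [CompleteSpace E] (hf : SmoothAlongCurves Set.univ f)
    (v : E) (p : ℕ) (x : E) : ∃ r > 0, ∃ C, ∀ y ∈ ball x r, ‖lineIter f v p y‖ ≤ C := by
  obtain ⟨δ, hδ, H⟩ := exists_curve_through
  by_contra! hcon
  -- This scaling makes `‖l k • v‖ ≤ δ k` and stays positive when `v = 0`.
  let l : ℕ → ℝ := fun k => δ k / (‖v‖ + 1)
  have hl (k : ℕ) : 0 < l k := div_pos (hδ k) (by positivity)
  choose y hyδ hyC using fun k => hcon (δ k) (hδ k) (k / l k ^ p)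
  obtain ⟨c, hc, hc0, hck, -⟩ := H (fun k => y k - x) (fun k => l k • v)
    (fun k => by rw [← dist_eq_norm]; exact (mem_ball.1 (hyδ k)).le)
    (fun k => by
      rw [norm_smul, Real.norm_of_nonneg (hl k).le, div_mul_eq_mul_div, div_le_iff₀ (by positivity)]
      nlinarith [hδ k, norm_nonneg v])
  have h1 := hf (fun t => x + c t) (contDiff_const.add hc) fun _ => Set.mem_univ _
  have h2 := h1.continuous_iteratedDeriv p (mod_cast le_top)
  have h3 : Tendsto (fun k => ‖iteratedDeriv p (f ∘ fun t => x + c t) (bumpCentre k)‖) atTop _ :=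
    ((h2.tendsto 0).comp tendsto_bumpCentre).norm
  have h4 (k : ℕ) : iteratedDeriv p (f ∘ fun t => x + c t) (bumpCentre k) =
      l k ^ p • lineIter f v p (y k) := by
    have e := congrFun (iteratedDeriv_comp_const_add p (f ∘ fun t => x + c t) (bumpCentre k)) 0
    simp only [add_zero] at e
    have e2 : (fun z => (f ∘ fun t => x + c t) (bumpCentre k + z)) =ᶠ[𝓝 0]
        fun s => f (y k + (l k * s) • v) := by
      filter_upwards [hck k] with s hs
      simp only [Function.comp_apply, hs]
      congr 1
      rw [smul_smul, mul_comm]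
      abel
    rw [← e, e2.iteratedDeriv_eq, iteratedDeriv_comp_const_smul (f := fun s : ℝ => f (y k + s • v))
      ((hf.line (y k) v).of_le (mod_cast le_top)) (l k)]
    simp [lineIter]
  obtain ⟨B, hB⟩ := h3.bddAbove_range
  obtain ⟨k, hk⟩ := exists_nat_gt B
  have h5 := hB (Set.mem_range_self k)
  simp only [h4, norm_smul, norm_pow, Real.norm_of_nonneg (hl k).le] at h5
  have h6 := hyC k
  rw [div_lt_iff₀ (pow_pos (hl k) p)] at h6
  linarith

end

end

/-! ### Boman's theorem on `ℝⁿ` by Fourier analysis. -/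

section

open Filter Topology Metric MeasureTheory FourierTransform
open scoped RealInnerProductSpace

/-- Continuity of these derivatives is not yet known. Being pointwise limits of difference quotients
they are measurable, which together with boundedness suffices for integration. -/
theorem SmoothAlongCurves.measurable_lineIter {n : ℕ} {f : Euc n → ℂ}
    (hf : SmoothAlongCurves Set.univ f) (v : Euc n) (p : ℕ) : Measurable (lineIter f v p) := by
  induction p with
  | zero =>
    simp only [funext (lineIter_zero (f := f) v)]
    exact (continuousOn_univ.1 (hf.continuousOn convex_univ)).measurable
  | succ p ih =>
    have ht : Tendsto (fun k : ℕ => 1 / ((k : ℝ) + 1)) atTop (𝓝[≠] 0) :=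
      tendsto_nhdsWithin_iff.2 ⟨tendsto_one_div_add_atTop_nhds_zero_nat,
        Eventually.of_forall fun k => (Nat.one_div_pos_of_nat (α := ℝ)).ne'⟩
    refine measurable_of_tendsto_metrizable (fun k : ℕ => ?_)
      (tendsto_pi_nhds.2 fun x => ((hf.hasLineDerivAt v x p).tendsto_slope_zero).comp ht)
    exact ((ih.comp (measurable_id.add_const _)).sub ih).const_smul _

theorem lineIter_eq_zero {n : ℕ} {f : Euc n → ℂ} {v x : Euc n} (hx : x ∉ tsupport f) (p : ℕ) :
    lineIter f v p x = 0 := by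
  have h1 : f =ᶠ[𝓝 x] 0 := notMem_tsupport_iff_eventuallyEq.1 hx
  have h2 : Tendsto (fun t : ℝ => x + t • v) (𝓝 0) (𝓝 x) := by
    have : Continuous (fun t : ℝ => x + t • v) := by fun_prop
    simpa using this.tendsto 0
  have h3 : (fun t : ℝ => f (x + t • v)) =ᶠ[𝓝 0] fun _ => 0 := h2.eventually h1
  rw [lineIter, h3.iteratedDeriv_eq]
  simp

theorem SmoothAlongCurves.exists_forall_bound {n : ℕ} {f : Euc n → ℂ}
    (hf : SmoothAlongCurves Set.univ f) (hc : HasCompactSupport f) (v : Euc n) (p : ℕ) :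
    ∃ C, ∀ x, ‖lineIter f v p x‖ ≤ C := by
  have h : ∃ C, ∀ y ∈ tsupport f, ‖lineIter f v p y‖ ≤ C := by
    refine IsCompact.induction_on (p := fun s => ∃ C, ∀ y ∈ s, ‖lineIter f v p y‖ ≤ C) hc
      ⟨0, fun y hy => hy.elim⟩ (fun s t hst ⟨C, hC⟩ => ⟨C, fun y hy => hC y (hst hy)⟩) ?_ ?_
    · rintro s t ⟨C, hC⟩ ⟨D, hD⟩
      refine ⟨max C D, fun y hy => ?_⟩
      rcases hy with hy | hy
      · exact (hC y hy).trans (le_max_left _ _)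
      · exact (hD y hy).trans (le_max_right _ _)
    · intro x _
      obtain ⟨r, hr, C, hC⟩ := hf.exists_bound v p x
      exact ⟨ball x r, mem_nhdsWithin_of_mem_nhds (ball_mem_nhds x hr), C, hC⟩
  obtain ⟨C, hC⟩ := h
  refine ⟨max C 0, fun x => ?_⟩
  by_cases hx : x ∈ tsupport f
  · exact (hC x hx).trans (le_max_left _ _)
  · rw [lineIter_eq_zero hx, norm_zero]
    exact le_max_right _ _

theorem SmoothAlongCurves.integrable_lineIter {n : ℕ} {f : Euc n → ℂ}
    (hf : SmoothAlongCurves Set.univ f) (hc : HasCompactSupport f) (v : Euc n) (p : ℕ) :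
    Integrable (lineIter f v p) := by
  obtain ⟨C, hC⟩ := hf.exists_forall_bound hc v p
  have h1 : Function.support (lineIter f v p) ⊆ tsupport f := fun x hx => by
    by_contra h
    exact hx (lineIter_eq_zero h p)
  rw [← integrableOn_iff_integrable_of_support_subset h1]
  exact Measure.integrableOn_of_bounded (hc.measure_lt_top).ne
    (hf.measurable_lineIter v p).aestronglyMeasurable (ae_of_all _ hC)

/-- The kernel of the Fourier transform. -/
noncomputable def fourierKernel {n : ℕ} (w x : Euc n) : ℂ :=
  Complex.exp ((↑(-2 * Real.pi * ⟪x, w⟫) * Complex.I))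

theorem norm_fourierKernel {n : ℕ} (w x : Euc n) : ‖fourierKernel w x‖ = 1 :=
  Complex.norm_exp_ofReal_mul_I _

theorem continuous_fourierKernel {n : ℕ} (w : Euc n) : Continuous (fourierKernel w) := by
  unfold fourierKernel
  fun_prop

theorem hasLineDerivAt_fourierKernel {n : ℕ} (w x v : Euc n) :
    HasLineDerivAt ℝ (fourierKernel w)
      (((-2 * Real.pi * ⟪v, w⟫ : ℝ) * Complex.I) * fourierKernel w x) x v := by
  unfold HasLineDerivAt fourierKernel
  have h1 : HasDerivAt (fun t : ℝ => -2 * Real.pi * ⟪x + t • v, w⟫)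
      (-2 * Real.pi * ⟪v, w⟫) 0 := by
    simp only [inner_add_left, inner_smul_left, RCLike.conj_to_real]
    have := (((hasDerivAt_id (0 : ℝ)).mul_const ⟪v, w⟫).const_add ⟪x, w⟫).const_mul
      (-2 * Real.pi)
    simpa using this
  have h2 := ((h1.ofReal_comp).mul_const Complex.I).cexp
  simp only [zero_smul, add_zero] at h2
  rw [mul_comm (_ * Complex.I)]
  exact h2

/-- Integration by parts against a plane wave. It uses only derivatives along the line in direction
`v` and integrability, so no Fréchet derivative of `f` is needed. -/
theorem SmoothAlongCurves.fourier_lineIter_succ {n : ℕ} {f : Euc n → ℂ}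
    (hf : SmoothAlongCurves Set.univ f) (hc : HasCompactSupport f) (v : Euc n) (p : ℕ)
    (w : Euc n) : 𝓕 (lineIter f v (p + 1)) w =
      ((2 * Real.pi * ⟪v, w⟫ : ℝ) * Complex.I) * 𝓕 (lineIter f v p) w := by
  have hbd {g : Euc n → ℂ} (hg : Integrable g) :
      Integrable (fun x => fourierKernel w x * g x) :=
    hg.bdd_mul (c := 1) (continuous_fourierKernel w).aestronglyMeasurable
      (ae_of_all _ fun x => (norm_fourierKernel w x).le)
  have h := integral_bilinear_hasLineDerivAt_right_eq_neg_left_of_integrable (μ := volume)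
    (f := fourierKernel w)
    (f' := fun x => ((-2 * Real.pi * ⟪v, w⟫ : ℝ) * Complex.I) * fourierKernel w x)
    (g := lineIter f v p) (g' := lineIter f v (p + 1)) (v := v) (B := ContinuousLinearMap.mul ℝ ℂ)
    (by
      simp only [ContinuousLinearMap.mul_apply', mul_assoc]
      exact ((hbd (hf.integrable_lineIter hc v p)).const_mul _).const_mul _)
    (hbd (hf.integrable_lineIter hc v (p + 1))) (hbd (hf.integrable_lineIter hc v p))
    (fun x _ => hasLineDerivAt_fourierKernel w x v) (fun x _ => hf.hasLineDerivAt v x p)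
  simp only [Real.fourier_eq', smul_eq_mul]
  simp only [ContinuousLinearMap.mul_apply', mul_assoc] at h
  rw [integral_const_mul, integral_const_mul] at h
  simp only [fourierKernel] at h
  rw [h]
  push_cast
  ring

theorem SmoothAlongCurves.fourier_lineIter {n : ℕ} {f : Euc n → ℂ}
    (hf : SmoothAlongCurves Set.univ f) (hc : HasCompactSupport f) (v : Euc n) (p : ℕ)
    (w : Euc n) : 𝓕 (lineIter f v p) w =
      ((2 * Real.pi * ⟪v, w⟫ : ℝ) * Complex.I) ^ p * 𝓕 f w := by
  induction p with
  | zero => simp [funext (lineIter_zero (f := f) v)]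
  | succ p ih => rw [hf.fourier_lineIter_succ hc, ih, pow_succ]; ring

/-- Reduces decay in the norm to decay in each coordinate, hence to derivatives along the axes. The
case `p = 0` is excluded because for `n = 0` the sum is empty while the left side would be 1. -/
theorem norm_pow_le_sum {n : ℕ} (x : Euc n) {p : ℕ} (hp : p ≠ 0) :
    ‖x‖ ^ p ≤ Real.sqrt n ^ p * ∑ j, |x j| ^ p := by
  rcases isEmpty_or_nonempty (Fin n) with h | h
  · have : x = 0 := Subsingleton.elim _ _
    simp [this, hp]
  obtain ⟨i, hi⟩ := Finite.exists_max fun j => |x j|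
  have h1 : ‖x‖ ≤ Real.sqrt n * |x i| := by
    rw [EuclideanSpace.norm_eq, ← Real.sqrt_sq (abs_nonneg (x i)), ← Real.sqrt_mul (by positivity)]
    apply Real.sqrt_le_sqrt
    calc ∑ j, ‖x j‖ ^ 2 ≤ ∑ _j : Fin n, |x i| ^ 2 := by
          refine Finset.sum_le_sum fun j _ => ?_
          rw [Real.norm_eq_abs]
          exact pow_le_pow_left₀ (abs_nonneg _) (hi j) 2
      _ = n * |x i| ^ 2 := by simp
  calc ‖x‖ ^ p ≤ (Real.sqrt n * |x i|) ^ p := pow_le_pow_left₀ (norm_nonneg _) h1 p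
    _ = Real.sqrt n ^ p * |x i| ^ p := mul_pow _ _ _
    _ ≤ _ := by
      gcongr
      exact Finset.single_le_sum (f := fun j => |x j| ^ p) (fun j _ => by positivity)
        (Finset.mem_univ i)

theorem SmoothAlongCurves.exists_fourier_bound {n : ℕ} {f : Euc n → ℂ}
    (hf : SmoothAlongCurves Set.univ f) (hc : HasCompactSupport f) (p : ℕ) :
    ∃ C, ∀ w, ‖w‖ ^ p * ‖𝓕 f w‖ ≤ C := by
  have h0 (v : Euc n) (p : ℕ) (w : Euc n) :
      ‖𝓕 (lineIter f v p) w‖ ≤ ∫ x, ‖lineIter f v p x‖ := by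
    rw [Real.fourier_eq]
    refine (norm_integral_le_integral_norm _).trans_eq ?_
    simp
  rcases eq_or_ne p 0 with rfl | hp
  · refine ⟨∫ x, ‖f x‖, fun w => ?_⟩
    have := h0 0 0 w
    rw [funext (lineIter_zero (f := f) 0)] at this
    simpa using this
  refine ⟨Real.sqrt n ^ p * ∑ j, ∫ x, ‖lineIter f (EuclideanSpace.single j 1) p x‖, fun w => ?_⟩
  have h1 (j : Fin n) : |w j| ^ p * ‖𝓕 f w‖ ≤
      ∫ x, ‖lineIter f (EuclideanSpace.single j 1) p x‖ := by
    refine le_trans ?_ (h0 _ p w)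
    rw [hf.fourier_lineIter hc, norm_mul, norm_pow]
    gcongr
    rw [norm_mul, Complex.norm_I, mul_one, Complex.norm_real, Real.norm_eq_abs, abs_mul]
    have h2 : ⟪EuclideanSpace.single j (1 : ℝ), w⟫ = w j := by
      simp [EuclideanSpace.inner_single_left]
    rw [h2]
    refine le_mul_of_one_le_left (abs_nonneg _) ?_
    rw [abs_of_pos (by positivity)]
    linarith [Real.pi_gt_three]
  calc ‖w‖ ^ p * ‖𝓕 f w‖ ≤ (Real.sqrt n ^ p * ∑ j, |w j| ^ p) * ‖𝓕 f w‖ := by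
        gcongr
        exact norm_pow_le_sum w hp
    _ = Real.sqrt n ^ p * ∑ j, |w j| ^ p * ‖𝓕 f w‖ := by rw [mul_assoc, Finset.sum_mul]
    _ ≤ _ := by
        gcongr with j
        exact h1 j

/-- The Fourier transform has integrable moments of all orders, so its own transform is smooth; by
inversion that is `f` up to a reflection. -/
theorem SmoothAlongCurves.contDiff_of_hasCompactSupport {n : ℕ} {f : Euc n → ℂ}
    (hf : SmoothAlongCurves Set.univ f) (hc : HasCompactSupport f) : ContDiff ℝ ∞ f := by
  have hcont : Continuous f := continuousOn_univ.1 (hf.continuousOn convex_univ)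
  have hint : Integrable f := hcont.integrable_of_hasCompactSupport hc
  have hFc : Continuous (𝓕 f) :=
    VectorFourier.fourierIntegral_continuous Real.continuous_fourierChar
      continuous_inner hint
  have hmom (k : ℕ) : Integrable (fun w => ‖w‖ ^ k * ‖𝓕 f w‖) := by
    obtain ⟨C, hC⟩ := hf.exists_fourier_bound hc 0
    -- The additional exponent provides a decay that is integrable over `ℝⁿ`.
    obtain ⟨D, hD⟩ := hf.exists_fourier_bound hc (k + (volume : Measure (Euc n)).integrablePower)
    exact integrable_of_le_of_pow_mul_le (fun w => by simpa using hC w) hD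
      hFc.aestronglyMeasurable
  have hF : Integrable (𝓕 f) := by
    have := hmom 0
    simp only [pow_zero, one_mul] at this
    exact (integrable_norm_iff hFc.aestronglyMeasurable).1 this
  have h1 : ContDiff ℝ ∞ (𝓕 (𝓕 f)) := Real.contDiff_fourier fun k _ => hmom k
  rw [← hcont.fourierInv_fourier_eq hint hF]
  have h2 : 𝓕⁻ (𝓕 f) = fun x => 𝓕 (𝓕 f) (-x) := funext fun x => Real.fourierInv_eq_fourier_neg _ x
  rw [h2]
  exact h1.comp contDiff_neg

/-- Boman's theorem on `ℝⁿ`. -/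
theorem SmoothAlongCurves.contDiff_euc {n : ℕ} {f : Euc n → ℝ}
    (hf : SmoothAlongCurves Set.univ f) : ContDiff ℝ ∞ f := by
  rw [contDiff_iff_contDiffAt]
  intro x
  -- Smoothness at `x` only concerns values near `x`, so `f` is cut off there; complex values are
  -- taken to match the Fourier argument.
  let χ : ContDiffBump x := ⟨1, 2, one_pos, one_lt_two⟩
  let g : Euc n → ℂ := fun y => ((χ y * f y : ℝ) : ℂ)
  have hg : SmoothAlongCurves Set.univ g := fun c hc hcK =>
    Complex.ofRealCLM.contDiff.comp ((χ.contDiff.comp hc).mul (hf c hc hcK))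
  have hgc : HasCompactSupport g := by
    have : HasCompactSupport fun y => χ y * f y := χ.hasCompactSupport.mul_right
    exact this.comp_left (g := Complex.ofReal) Complex.ofReal_zero
  have h1 := Complex.reCLM.contDiff.comp (hg.contDiff_of_hasCompactSupport hgc)
  refine h1.contDiffAt.congr_of_eventuallyEq ?_
  filter_upwards [χ.eventuallyEq_one] with y hy
  simp [g, hy]

/-- **Boman's theorem**: a function which is smooth along all smooth curves is smooth. -/
theorem SmoothAlongCurves.contDiff {E : Type*} [NormedAddCommGroup E] [NormedSpace ℝ E]
    [FiniteDimensional ℝ E] {f : E → ℝ} (hf : SmoothAlongCurves Set.univ f) :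
    ContDiff ℝ ∞ f := by
  let e := toEuclidean (E := E)
  have h : SmoothAlongCurves Set.univ (f ∘ e.symm) := fun c hc _ =>
    hf _ (e.symm.contDiff.comp hc) fun _ => Set.mem_univ _
  have h1 := h.contDiff_euc.comp e.contDiff
  have h2 : (f ∘ e.symm) ∘ e = f := by
    funext x
    simp
  rwa [h2] at h1

end

/-! ### Convex sets: smoothness up to the boundary. -/

section

open Filter Topology Metric

section Convex

variable {E : Type} [NormedAddCommGroup E] [InnerProductSpace ℝ E]
  {K : Set E} {f : E → ℝ}

theorem SmoothAlongCurves.contDiff_comp (hf : SmoothAlongCurves K f) {G : Type*}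
    [NormedAddCommGroup G] [NormedSpace ℝ G] [FiniteDimensional ℝ G] {φ : G → E}
    (hφ : ContDiff ℝ ∞ φ) (h : ∀ u, φ u ∈ K) : ContDiff ℝ ∞ (f ∘ φ) :=
  SmoothAlongCurves.contDiff fun c hc _ => hf (φ ∘ c) (hφ.comp hc) fun _ => h _

/-- A ball in the interior is diffeomorphic to the whole space, where Boman's theorem applies. -/
theorem SmoothAlongCurves.contDiffAt_interior [FiniteDimensional ℝ E] (hf : SmoothAlongCurves K f)
    {x : E} (hx : x ∈ interior K) : ContDiffAt ℝ ∞ f x := by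
  obtain ⟨r, hr, hK⟩ := Metric.isOpen_iff.1 isOpen_interior x hx
  have h1 := hf.contDiff_comp (φ := OpenPartialHomeomorph.univBall x r)
    OpenPartialHomeomorph.contDiff_univBall fun u => by
      refine interior_subset (hK ?_)
      rw [← OpenPartialHomeomorph.univBall_target x hr]
      exact (OpenPartialHomeomorph.univBall x r).map_source (by simp)
  have h2 : ContDiffOn ℝ ∞ ((f ∘ OpenPartialHomeomorph.univBall x r) ∘
      (OpenPartialHomeomorph.univBall x r).symm) (ball x r) :=
    h1.comp_contDiffOn OpenPartialHomeomorph.contDiffOn_univBall_symm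
  refine (h2.contDiffAt (ball_mem_nhds x hr)).congr_of_eventuallyEq ?_
  filter_upwards [ball_mem_nhds x hr] with y hy
  rw [← OpenPartialHomeomorph.univBall_target x hr] at hy
  simp [(OpenPartialHomeomorph.univBall x r).right_inv hy]

/-- The reparametrization `t ↦ t² / (1 + t²)`, with values in `[0, 1)`. -/
noncomputable def squash (t : ℝ) : ℝ := t ^ 2 / (1 + t ^ 2)

theorem contDiff_squash : ContDiff ℝ ∞ squash := by
  unfold squash
  exact (contDiff_id.pow 2).div (contDiff_const.add (contDiff_id.pow 2)) fun t => by positivity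

theorem squash_mem (t : ℝ) : squash t ∈ Set.Icc (0 : ℝ) 1 := by
  unfold squash
  refine ⟨by positivity, ?_⟩
  rw [div_le_one (by positivity)]
  linarith

theorem squash_zero : squash 0 = 0 := by simp [squash]

theorem hasDerivAt_squash (t : ℝ) : HasDerivAt squash (2 * t / (1 + t ^ 2) ^ 2) t := by
  have h : (1 + t ^ 2 : ℝ) ≠ 0 := by positivity
  have := (hasDerivAt_pow 2 t).div ((hasDerivAt_pow 2 t).const_add 1) h
  refine this.congr_deriv ?_
  field_simp
  ring

theorem hasDerivAt_deriv_squash : HasDerivAt (fun t : ℝ => 2 * t / (1 + t ^ 2) ^ 2) 2 0 := by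
  have := ((hasDerivAt_id (0 : ℝ)).const_mul 2).div
    (((hasDerivAt_pow 2 (0 : ℝ)).const_add 1).pow 2) (by norm_num)
  refine this.congr_deriv ?_
  norm_num

/-- The derivative of `f` at `x` in the direction `a - x`, obtained from the second derivative
of a curve which starts at `x` with velocity zero. -/
noncomputable def derivTowards (f : E → ℝ) (a x : E) : ℝ :=
  1 / 2 * iteratedDeriv 2 (fun t => f (x + squash t • (a - x))) 0

theorem contDiff_iteratedDeriv_two {F : ℝ × ℝ → ℝ} (hF : ContDiff ℝ ∞ F) :
    ContDiff ℝ ∞ fun s => iteratedDeriv 2 (fun t => F (s, t)) 0 := by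
  have key {G : ℝ × ℝ → ℝ} (hG : ContDiff ℝ ∞ G) :
      ContDiff ℝ ∞ (fun q : ℝ × ℝ => fderiv ℝ G q (0, 1)) ∧
        ∀ s, deriv (fun t => G (s, t)) = fun t => fderiv ℝ G (s, t) (0, 1) := by
    refine ⟨(hG.fderiv_right (m := ∞) (by simp)).clm_apply contDiff_const, fun s => ?_⟩
    funext t
    have h1 : HasDerivAt (fun t : ℝ => (s, t)) (0, 1) t :=
      (hasDerivAt_const t s).prodMk (hasDerivAt_id t)
    exact ((hG.differentiable (by simp) (s, t)).hasFDerivAt.comp_hasDerivAt t h1).deriv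
  obtain ⟨h1, e1⟩ := key hF
  obtain ⟨h2, e2⟩ := key h1
  have e3 (s : ℝ) : iteratedDeriv 2 (fun t => F (s, t)) 0 =
      fderiv ℝ (fun q : ℝ × ℝ => fderiv ℝ F q (0, 1)) (s, 0) (0, 1) := by
    rw [iteratedDeriv_succ, iteratedDeriv_one, e1 s, e2 s]
  simp only [e3]
  exact h2.comp (contDiff_id.prodMk contDiff_const)

/-- Along `c` this is a second partial derivative of `f` on the family `(s, t) ↦ c s + squash t • (a
- c s)`. Convexity keeps the family in `K`, and Boman's theorem in the plane makes `f` smooth on it.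
-/
theorem SmoothAlongCurves.smoothAlongCurves_derivTowards (hf : SmoothAlongCurves K f) (hK : Convex ℝ K) {a : E}
    (ha : a ∈ K) : SmoothAlongCurves K (derivTowards f a) := by
  intro c hc hcK
  have h : ContDiff ℝ ∞ fun q : ℝ × ℝ => c q.1 + squash q.2 • (a - c q.1) :=
    (hc.comp contDiff_fst).add ((contDiff_squash.comp contDiff_snd).smul
      (contDiff_const.sub (hc.comp contDiff_fst)))
  have h1 := hf.contDiff_comp h fun q => hK.add_smul_sub_mem (hcK q.1) ha (squash_mem q.2)
  have h2 : derivTowards f a ∘ c = fun s => 1 / 2 * iteratedDeriv 2 (fun t =>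
      (f ∘ fun q : ℝ × ℝ => c q.1 + squash q.2 • (a - c q.1)) (s, t)) 0 := rfl
  rw [h2]
  exact contDiff_const.mul (contDiff_iteratedDeriv_two h1)

/-- At 0 the first derivative of `squash` is 0 and the second is 2. Hence only the first derivative
of `f` survives in the second derivative along the curve, with a factor 2. -/
theorem SmoothAlongCurves.derivTowards_eq [FiniteDimensional ℝ E] (hf : SmoothAlongCurves K f)
    (a : E) {x : E} (hx : x ∈ interior K) : derivTowards f a x = fderiv ℝ f x (a - x) := by
  let γ : ℝ → E := fun t => x + squash t • (a - x)
  have hγ : ContDiff ℝ ∞ γ := contDiff_const.add (contDiff_squash.smul contDiff_const)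
  have hγ0 : γ 0 = x := by simp [γ, squash_zero]
  have hnear : ∀ᶠ t in 𝓝 (0 : ℝ), γ t ∈ interior K :=
    hγ.continuous.continuousAt.eventually (by rw [hγ0]; exact isOpen_interior.mem_nhds hx)
  have hd : ∀ᶠ t in 𝓝 (0 : ℝ), deriv (fun t => f (γ t)) t =
      (2 * t / (1 + t ^ 2) ^ 2) * fderiv ℝ f (γ t) (a - x) := by
    filter_upwards [hnear] with t ht
    have h1 : HasDerivAt γ ((2 * t / (1 + t ^ 2) ^ 2) • (a - x)) t :=
      ((hasDerivAt_squash t).smul_const (a - x)).const_add x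
    have h2 := (((hf.contDiffAt_interior ht).differentiableAt (by simp)).hasFDerivAt).comp_hasDerivAt
      t h1
    rw [map_smul, smul_eq_mul] at h2
    exact h2.deriv
  have hq : DifferentiableAt ℝ (fun t => fderiv ℝ f (γ t) (a - x)) 0 := by
    have h1 : ContDiffAt ℝ ∞ (fderiv ℝ f) (γ 0) := by
      rw [hγ0]
      exact (hf.contDiffAt_interior hx).fderiv_right (by simp)
    exact ((h1.comp (0 : ℝ) hγ.contDiffAt).differentiableAt (by simp)).clm_apply
      (differentiableAt_const _)
  have h3 := (hasDerivAt_deriv_squash.mul hq.hasDerivAt).congr_of_eventuallyEq hd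
  have h4 : iteratedDeriv 2 (fun t => f (γ t)) 0 = 2 * fderiv ℝ f x (a - x) := by
    rw [iteratedDeriv_succ, iteratedDeriv_one, h3.deriv]
    simp [hγ0]
  rw [derivTowards, h4]
  ring

/-- A continuous function on a convex set whose derivative in the interior extends continuously
to the whole set is differentiable there. -/
theorem hasFDerivWithinAt_of_interior {L : E → E →L[ℝ] ℝ} (hK : Convex ℝ K) {a : E}
    (ha : a ∈ interior K) (hf : ContinuousOn f K) (hL : ContinuousOn L K)
    (h : ∀ x ∈ interior K, HasFDerivAt f (L x) x) {x : E} (hx : x ∈ K) :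
    HasFDerivWithinAt f (L x) K x := by
  refine hasFDerivWithinAt_iff_isLittleO.2 (Asymptotics.isLittleO_iff.2 fun ε hε => ?_)
  obtain ⟨δ, hδ, hLδ⟩ := Metric.continuousWithinAt_iff.1 (hL x hx) ε hε
  have hs : Convex ℝ (interior K ∩ ball x δ) := hK.interior.inter (convex_ball x δ)
  have hlim (z : E) : Tendsto (fun θ : ℝ => z + θ • (a - z)) (𝓝[>] 0) (𝓝 z) := by
    have h1 : Continuous fun θ : ℝ => z + θ • (a - z) := by fun_prop
    simpa using (h1.tendsto 0).mono_left nhdsWithin_le_nhds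
  have hIoc : ∀ᶠ θ : ℝ in 𝓝[>] 0, θ ∈ Set.Ioc (0 : ℝ) 1 := Ioc_mem_nhdsGT one_pos
  have hint {z : E} (hz : z ∈ K) : ∀ᶠ θ : ℝ in 𝓝[>] 0, z + θ • (a - z) ∈ interior K := by
    filter_upwards [hIoc] with θ hθ
    exact hK.add_smul_sub_mem_interior hz ha hθ
  have hflim {z : E} (hz : z ∈ K) :
      Tendsto (fun θ : ℝ => f (z + θ • (a - z))) (𝓝[>] 0) (𝓝 (f z)) :=
    (hf z hz).tendsto.comp (tendsto_nhdsWithin_iff.2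
      ⟨hlim z, (hint hz).mono fun _ h => interior_subset h⟩)
  filter_upwards [self_mem_nhdsWithin, mem_nhdsWithin_of_mem_nhds (ball_mem_nhds x hδ)]
    with y hy hyδ
  -- The mean value inequality holds between interior points near `x`. Both end points are moved
  -- slightly towards `a`, into the interior, and the estimate passes to the limit.
  refine le_of_tendsto_of_tendsto (((((hflim hy).sub (hflim hx)).sub
    (((L x).continuous.tendsto _).comp ((hlim y).sub (hlim x))))).norm)
    (((hlim y).sub (hlim x)).norm.const_mul ε) ?_
  filter_upwards [hint hx, hint hy, (hlim x).eventually (ball_mem_nhds x hδ),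
    (hlim y).eventually (isOpen_ball.mem_nhds hyδ)] with θ h1 h2 h3 h4
  exact hs.norm_image_sub_le_of_norm_hasFDerivWithin_le'
    (fun z hz => (h z hz.1).hasFDerivWithinAt) (fun z hz => by
      rw [← dist_eq_norm]; exact (hLδ (interior_subset hz.1) hz.2).le) ⟨h1, h3⟩ ⟨h2, h4⟩

/-- The differential is a combination of functions `derivTowards f` for finitely many targets in
`K`. These are again smooth along curves, so an induction on `m` for all `f` simultaneously shows
that the differential is of class `C^m`. -/
theorem SmoothAlongCurves.contDiffOn_nat [FiniteDimensional ℝ E] (hK : Convex ℝ K) (hKi : (interior K).Nonempty) (m : ℕ) :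
    ∀ {f : E → ℝ}, SmoothAlongCurves K f → ContDiffOn ℝ m f K := by
  obtain ⟨a, ha⟩ := hKi
  induction m with
  | zero => exact fun hf => contDiffOn_zero.2 (hf.continuousOn hK)
  | succ m ih =>
    intro f hf
    let b := Module.finBasis ℝ E
    have hε : ∃ ε : ℝ, ε ≠ 0 ∧ ∀ j, a + ε • b j ∈ K := by
      have h1 : ∀ᶠ ε : ℝ in 𝓝 0, ∀ j, a + ε • b j ∈ K := by
        refine eventually_all.2 fun j => ?_
        have h2 : Continuous fun ε : ℝ => a + ε • b j := by fun_prop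
        filter_upwards [h2.continuousAt.eventually
          (isOpen_interior.mem_nhds (by simpa using ha))] with ε h
        exact interior_subset h
      obtain ⟨ε, h2, h3⟩ := ((h1.filter_mono nhdsWithin_le_nhds).and
        (self_mem_nhdsWithin (s := {(0 : ℝ)}ᶜ))).exists
      exact ⟨ε, h3, h2⟩
    obtain ⟨ε, hε0, hε⟩ := hε
    -- In the interior the difference for the targets `a + ε • b j` and `a` is the differential
    -- applied to `ε • b j`. The formula also makes sense on the boundary.
    let L : E → E →L[ℝ] ℝ := fun x => ∑ j,
      (ε⁻¹ * (derivTowards f (a + ε • b j) x - derivTowards f a x)) •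
        (b.coord j).toContinuousLinearMap
    have hL : ContDiffOn ℝ m L K := ContDiffOn.sum fun j _ =>
      (contDiffOn_const.mul ((ih (hf.smoothAlongCurves_derivTowards hK (hε j))).sub
        (ih (hf.smoothAlongCurves_derivTowards hK (interior_subset ha))))).smul contDiffOn_const
    have hLi (x : E) (hx : x ∈ interior K) : HasFDerivAt f (L x) x := by
      have h1 : L x = fderiv ℝ f x := by
        refine ContinuousLinearMap.coe_injective (b.ext fun i => ?_)
        have h2 : L x (b i) = fderiv ℝ f x (b i) := by
          simp only [L, hf.derivTowards_eq _ hx, _root_.sum_apply,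
            _root_.smul_apply, LinearMap.coe_toContinuousLinearMap',
            Module.Basis.coord_apply, Module.Basis.repr_self, smul_eq_mul]
          rw [Finset.sum_eq_single i (fun j _ hj => by simp [hj.symm])
            (fun h => absurd (Finset.mem_univ i) h), ← map_sub]
          have : a + ε • b i - x - (a - x) = ε • b i := by abel
          rw [this]
          simp [hε0]
        exact h2
      rw [h1]
      exact ((hf.contDiffAt_interior hx).differentiableAt (by simp)).hasFDerivAt
    have h5 := (contDiffOn_succ_iff_hasFDerivWithinAt_of_uniqueDiffOn (𝕜 := ℝ) (n := m) (f := f)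
      (uniqueDiffOn_convex hK ⟨a, ha⟩)).2 ⟨fun h => by simp at h, L, hL, fun x hx =>
        hasFDerivWithinAt_of_interior hK ha (hf.continuousOn hK) hL.continuousOn hLi hx⟩
    exact_mod_cast h5

theorem SmoothAlongCurves.contDiffOn_of_interior [FiniteDimensional ℝ E]
    (hf : SmoothAlongCurves K f) (hK : Convex ℝ K) (hKi : (interior K).Nonempty) : ContDiffOn ℝ ∞ f K :=
  contDiffOn_infty.2 fun m => SmoothAlongCurves.contDiffOn_nat hK hKi m hf

/-- **Kriegl's theorem**: a function on a convex set which is smooth along all smooth curves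
is smooth up to the boundary. -/
theorem SmoothAlongCurves.contDiffOn [FiniteDimensional ℝ E] (hf : SmoothAlongCurves K f)
    (hK : Convex ℝ K) : ContDiffOn ℝ ∞ f K := by
  rcases K.eq_empty_or_nonempty with rfl | hne
  · exact fun x hx => hx.elim
  obtain ⟨p, hp⟩ := hne
  -- `K` may have empty interior in `E`, but it has interior points in its affine span. The span is
  -- parametrized by its direction `V`, and orthogonal projection leads back.
  let A := affineSpan ℝ K
  have hpA : p ∈ A := subset_affineSpan ℝ K hp
  let V := A.direction
  let j : V → E := fun v => p + v
  have hj : ContDiff ℝ ∞ j := contDiff_const.add V.subtypeL.contDiff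
  let π : E → V := fun y => V.orthogonalProjectionOnto (y - p)
  have hπ : ContDiff ℝ ∞ π := V.orthogonalProjectionOnto.contDiff.comp (contDiff_id.sub contDiff_const)
  have hπj (y : E) (hy : y ∈ K) : j (π y) = y := by
    have h1 : y - p ∈ V := AffineSubspace.vsub_mem_direction (subset_affineSpan ℝ K hy) hpA
    have h2 : ((V.orthogonalProjectionOnto (y - p) : V) : E) = y - p :=
      V.starProjection_eq_self_iff.2 h1
    simp only [j, π, h2]
    abel
  have hK' : Convex ℝ (j ⁻¹' K) := by
    have : j ⁻¹' K = V.subtype ⁻¹' ((fun z => p + z) ⁻¹' K) := rfl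
    rw [this]
    exact (hK.translate_preimage_right p).linear_preimage V.subtype
  have hint : (interior (j ⁻¹' K)).Nonempty := by
    obtain ⟨z, z', hz', rfl⟩ := Set.Nonempty.intrinsicInterior hK ⟨p, hp⟩
    let g : V → A := fun v => ⟨p + v, by
      rw [add_comm]; exact AffineSubspace.vadd_mem_of_mem_direction v.2 hpA⟩
    have hg : Continuous g := Continuous.subtype_mk (by fun_prop) _
    have hg_sub : g ⁻¹' interior ((↑) ⁻¹' K) ⊆ j ⁻¹' K := fun v hv =>
      interior_subset (s := ((↑) : A → E) ⁻¹' K) hv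
    refine ⟨⟨z' - p, AffineSubspace.vsub_mem_direction z'.2 hpA⟩, mem_interior.2
      ⟨g ⁻¹' interior ((↑) ⁻¹' K), hg_sub, isOpen_interior.preimage hg, ?_⟩⟩
    have : g ⟨z' - p, AffineSubspace.vsub_mem_direction z'.2 hpA⟩ = z' :=
      Subtype.ext (add_sub_cancel p (z' : E))
    rwa [Set.mem_preimage, this]
  have h1 : SmoothAlongCurves (j ⁻¹' K) (f ∘ j) := fun c hc hcK => hf (j ∘ c) (hj.comp hc) hcK
  have h2 := (h1.contDiffOn_of_interior hK' hint).comp (hπ.contDiffOn (s := K))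
    fun y hy => by
      change j (π y) ∈ K
      rwa [hπj y hy]
  exact h2.congr fun y hy => by simp [hπj y hy]

end Convex

end

section

open Filter Topology Metric

/-! ### Smooth maps between test spaces -/

theorem isSmooth_of_contDiff {S T : TestSpace} {f : S → T} (g : Euc S.dim → Euc T.dim)
    (hg : ContDiff ℝ ∞ g) (h : ∀ x : S, g x = f x) : IsSmooth f :=
  ⟨g, hg.contDiffOn, h⟩

theorem isSmooth_id (S : TestSpace) : IsSmooth (id : S → S) :=
  isSmooth_of_contDiff id contDiff_id fun _ => rfl

theorem isSmooth_const {S T : TestSpace} (y : T) : IsSmooth (fun _ : S => y) :=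
  isSmooth_of_contDiff _ (contDiff_const (c := (y : Euc T.dim))) fun _ => rfl

theorem isSmooth_of_subsingleton {S T : TestSpace} [Subsingleton S] (f : S → T) : IsSmooth f := by
  rcases isEmpty_or_nonempty S with h | ⟨⟨x⟩⟩
  · exact isSmooth_of_contDiff (fun _ => 0) contDiff_const fun x => h.elim x
  · rw [show f = fun _ => f x from funext fun y => congrArg f (Subsingleton.elim _ _)]
    exact isSmooth_const _

theorem isSmooth_to_subsingleton {S T : TestSpace} [Subsingleton T] (f : S → T) : IsSmooth f := by
  rcases isEmpty_or_nonempty S with h | ⟨⟨x⟩⟩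
  · exact isSmooth_of_contDiff (fun _ => 0) contDiff_const fun x => h.elim x
  · rw [show f = fun _ => f x from funext fun y => Subsingleton.elim _ _]
    exact isSmooth_const _

/-- A map to a test space with values in a piece of it. -/
def cutMk {α : Type*} {T : TestSpace} {V : Set (Euc T.dim)} (f : α → T)
    (h : ∀ x, (f x : Euc T.dim) ∈ V) (x : α) : T.cut V :=
  ⟨((f x : T) : Euc T.dim), (f x).2, h x⟩

/-- The inclusion of a piece of a test space. -/
def cutIncl (S : TestSpace) (U : Set (Euc S.dim)) (y : S.cut U) : S := ⟨y.1, y.2.1⟩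

theorem isSmooth_cutIncl (S : TestSpace) (U : Set (Euc S.dim)) : IsSmooth (cutIncl S U) :=
  isSmooth_of_contDiff (S := S.cut U) id contDiff_id fun _ => rfl

theorem IsSmooth.codRestrict {S T : TestSpace} {f : S → T} (hf : IsSmooth f)
    {V : Set (Euc T.dim)} (h : ∀ x, (f x : Euc T.dim) ∈ V) :
    IsSmooth (cutMk f h) := by
  obtain ⟨g, hg, e⟩ := hf
  exact ⟨g, hg, e⟩

/-- No partition of unity is needed: `ContDiffOn` is a condition at each point relative to the set,
so the extension of `f` by zero serves as witness. -/
theorem isSmooth_of_locally {S T : TestSpace} {f : S → T}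
    (h : ∀ x : S, ∃ U : Set (Euc S.dim), IsOpen U ∧ (x : Euc S.dim) ∈ U ∧
      IsSmooth (f ∘ cutIncl S U)) : IsSmooth f := by
  classical
  refine ⟨fun y => if hy : y ∈ S.carrier then f ⟨y, hy⟩ else 0, fun x hx => ?_, fun x => by simp⟩
  obtain ⟨U, hU, hxU, (g : Euc S.dim → Euc T.dim), hg, e⟩ := h ⟨x, hx⟩
  have h1 : ContDiffWithinAt ℝ ∞ g S.carrier x :=
    (hg x ⟨hx, hxU⟩).mono_of_mem_nhdsWithin
      (inter_mem self_mem_nhdsWithin (mem_nhdsWithin_of_mem_nhds (hU.mem_nhds hxU)))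
  have h2 (y : Euc S.dim) (hy : y ∈ S.carrier) (hyU : y ∈ U) : f ⟨y, hy⟩ = g y :=
    (e ⟨y, hy, hyU⟩).symm
  refine h1.congr_of_eventuallyEq ?_ ?_
  · filter_upwards [self_mem_nhdsWithin, mem_nhdsWithin_of_mem_nhds (hU.mem_nhds hxU)]
      with y hy hyU
    rw [dif_pos hy, h2 y hy hyU]
  · rw [dif_pos hx, h2 x hx hxU]

theorem isSmooth_coordinate (S : TestSpace) (j : Fin S.dim) : IsSmooth (coordinate S j) := by
  refine isSmooth_of_contDiff (T := realLine) (fun x => WithLp.toLp 2 fun _ => x j) ?_ fun _ => rfl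
  exact contDiff_euclidean.2 fun _ => (EuclideanSpace.proj (𝕜 := ℝ) j).contDiff

theorem isSmooth_of_coordinates {S T : TestSpace} {f : S → T}
    (h : ∀ j, IsSmooth (coordinate T j ∘ f)) : IsSmooth f := by
  choose g hg e using h
  have e' (j) (x : S) : g j x (0 : Fin 1) = (f x : Euc T.dim) j := by
    rw [e j x]; rfl
  refine ⟨fun x => WithLp.toLp 2 fun j => g j x (0 : Fin 1), ?_, fun x => ?_⟩
  · exact contDiffOn_euclidean.2 fun j => contDiffOn_euclidean.1 (hg j) (0 : Fin 1)
  · ext j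
    exact e' j x

theorem isSmooth_of_curves_of_convex {S T : TestSpace} (hS : Convex ℝ S.carrier) {f : S → T}
    (h : ∀ c : realLine → S, IsSmooth c → IsSmooth (f ∘ c)) : IsSmooth f := by
  classical
  let F : Fin T.dim → Euc S.dim → ℝ := fun j y =>
    if hy : y ∈ S.carrier then (f ⟨y, hy⟩ : Euc T.dim) j else 0
  have hF (j : Fin T.dim) : ContDiffOn ℝ ∞ (F j) S.carrier := by
    refine SmoothAlongCurves.contDiffOn (fun c hc hcS => ?_) hS
    let c' : realLine → S := fun t => ⟨c (t.1 (0 : Fin 1)), hcS _⟩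
    have hc' : IsSmooth c' := isSmooth_of_contDiff (S := realLine)
      (fun t => c (t (0 : Fin 1))) (hc.comp (EuclideanSpace.proj (𝕜 := ℝ) (0 : Fin 1)).contDiff)
      fun _ => rfl
    obtain ⟨(g : Euc 1 → Euc T.dim), hg, e⟩ := h c' hc'
    have hl : ContDiff ℝ ∞ fun t : ℝ => (WithLp.toLp 2 fun _ => t : Euc 1) :=
      contDiff_euclidean.2 fun _ => contDiff_id
    have h1 : F j ∘ c = fun t : ℝ => g (WithLp.toLp 2 fun _ => t : Euc 1) j := by
      funext t
      have h2 : g (WithLp.toLp 2 fun _ => t) = (f ⟨c t, hcS t⟩ : Euc T.dim) :=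
        e ⟨WithLp.toLp 2 fun _ => t, Set.mem_univ _⟩
      rw [h2]
      exact dif_pos (hcS t)
    rw [h1]
    exact contDiff_euclidean.1 ((contDiffOn_univ.1 hg).comp hl) j
  refine ⟨fun x => WithLp.toLp 2 fun j => F j x, contDiffOn_euclidean.2 hF, fun x => ?_⟩
  ext j
  simp [F]

/-- Maps on `S` are smooth as soon as they are smooth along all smooth curves. -/
def CurveDetermined (S : TestSpace) : Prop :=
  ∀ ⦃T : TestSpace⦄ ⦃f : S → T⦄,
    (∀ c : realLine → S, IsSmooth c → IsSmooth (f ∘ c)) → IsSmooth f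

theorem curveDetermined_of_convex {S : TestSpace} (hS : Convex ℝ S.carrier) : CurveDetermined S :=
  fun _ _ h => isSmooth_of_curves_of_convex hS h

theorem exists_cut_open {S : TestSpace} (hS : IsOpen S.carrier) (x : S) {U : Set (Euc S.dim)}
    (hU : IsOpen U) (hx : (x : Euc S.dim) ∈ U) : ∃ V ⊆ U, IsOpen V ∧ (x : Euc S.dim) ∈ V ∧
      S.cut V ∈ openTests ∩ convexTests := by
  obtain ⟨r, hr, h⟩ := Metric.isOpen_iff.1 (hS.inter hU) x ⟨x.2, hx⟩
  refine ⟨ball x r, h.trans Set.inter_subset_right, isOpen_ball, mem_ball_self hr,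
    hS.inter isOpen_ball, ?_⟩
  change Convex ℝ (S.carrier ∩ ball _ r)
  rw [Set.inter_eq_self_of_subset_right (h.trans Set.inter_subset_left)]
  exact convex_ball _ _

theorem exists_cut_convex {S : TestSpace} (hS : Convex ℝ S.carrier) (x : S) {U : Set (Euc S.dim)}
    (hU : IsOpen U) (hx : (x : Euc S.dim) ∈ U) : ∃ V ⊆ U, IsOpen V ∧ (x : Euc S.dim) ∈ V ∧
      S.cut V ∈ convexTests := by
  obtain ⟨r, hr, h⟩ := Metric.isOpen_iff.1 hU x hx
  exact ⟨ball x r, h, isOpen_ball, mem_ball_self hr, hS.inter (convex_ball _ _)⟩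

theorem curveDetermined_of_open {S : TestSpace} (hS : IsOpen S.carrier) : CurveDetermined S := by
  intro T f h
  refine isSmooth_of_locally fun x => ?_
  obtain ⟨V, -, hV, hxV, -, hc⟩ := exists_cut_open hS x isOpen_univ (Set.mem_univ _)
  exact ⟨V, hV, hxV, isSmooth_of_curves_of_convex hc fun c hc =>
    h _ ((isSmooth_cutIncl S V).comp hc)⟩

theorem curveDetermined_of_euclidean {S : TestSpace} (hS : S ∈ euclideanTests) :
    CurveDetermined S :=
  curveDetermined_of_open (by rw [show S.carrier = Set.univ from hS]; exact isOpen_univ)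

/-- The one-point test space. -/
def pointTest : TestSpace := ⟨0, Set.univ⟩

instance : Subsingleton pointTest := inferInstanceAs (Subsingleton (Set.univ : Set (Euc 0)))

theorem isTerminalTest_pointTest (𝒯 : Set TestSpace) : IsTerminalTest 𝒯 pointTest := fun _ _ =>
  ⟨fun _ => ⟨0, Set.mem_univ _⟩, isSmooth_const _, fun _ _ => funext fun _ => Subsingleton.elim _ _⟩

theorem IsTerminalTest.nonempty {𝒯 : Set TestSpace} (h𝒯 : realLine ∈ 𝒯) {S : TestSpace}
    (hS : IsTerminalTest 𝒯 S) : Nonempty S :=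
  let ⟨f, _, _⟩ := hS realLine h𝒯
  ⟨f ⟨0, Set.mem_univ _⟩⟩

/-- Constant maps from the line are smooth, so two different points would give two smooth maps. -/
theorem IsTerminalTest.subsingleton {𝒯 : Set TestSpace} (h𝒯 : realLine ∈ 𝒯) {S : TestSpace}
    (hS : IsTerminalTest 𝒯 S) : Subsingleton S :=
  ⟨fun x y => congrFun ((hS realLine h𝒯).unique (isSmooth_const x) (isSmooth_const y))
    ⟨0, Set.mem_univ _⟩⟩

/-! ### Underlying categories -/

/-- The morphisms of the underlying category and the morphisms from and to test spaces can be
composed with each other and with smooth maps, and constant maps are morphisms. -/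
structure Underlying.IsRegular (B : Underlying.{u}) : Prop where
  in_comp : ∀ {X : Type u} {b : B.Str X} {S T : TestSpace} {f : S → T} {i : T → X},
    IsSmooth f → i ∈ B.inMor b T → i ∘ f ∈ B.inMor b S
  out_comp : ∀ {X : Type u} {b : B.Str X} {S T : TestSpace} {f : S → T} {o : X → S},
    IsSmooth f → o ∈ B.outMor b S → f ∘ o ∈ B.outMor b T
  mor_in : ∀ {X Y : Type u} {b : B.Str X} {c : B.Str Y} {f : X → Y} {S : TestSpace} {i : S → X},
    f ∈ B.mor b c → i ∈ B.inMor b S → f ∘ i ∈ B.inMor c S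
  mor_out : ∀ {X Y : Type u} {b : B.Str X} {c : B.Str Y} {f : X → Y} {S : TestSpace} {o : Y → S},
    f ∈ B.mor b c → o ∈ B.outMor c S → o ∘ f ∈ B.outMor b S

theorem isRegular_sets : sets.{u}.IsRegular :=
  ⟨fun _ _ => trivial, fun _ _ => trivial, fun _ _ => trivial, fun _ _ => trivial⟩

theorem isRegular_topologicalSpaces : topologicalSpaces.{u}.IsRegular where
  in_comp {_ b _ _ _ _} hf hi := @Continuous.comp _ _ _ _ _ b _ _ hi hf.continuous
  out_comp {_ b _ _ _ _} hf ho := @Continuous.comp _ _ _ b _ _ _ _ hf.continuous ho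
  mor_in {_ _ b c _ _ _} hf hi := @Continuous.comp _ _ _ _ b c _ _ hf hi
  mor_out {_ _ b c _ _ _} hf ho := @Continuous.comp _ _ _ b c _ _ _ ho hf

/-! ### Functors which only change the test maps -/

section

variable {B : Underlying.{u}} {𝒮 𝒯 ℛ : Set TestSpace}

theorem isMor_id_of_le {X : Type u} {b : B.Str X} {V W : VirtualStr B 𝒯 b} (h : V ≤ W) :
    IsMor V W id :=
  ⟨B.id_mor b, fun S _ hi => h.1 S hi, fun S _ ho => h.2 S ho⟩

namespace FibreFunctor

variable {P : Condition B 𝒯} {Q : Condition B 𝒮} {R : Condition B ℛ}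

/-- Composition of fibre functors. -/
def comp (F : FibreFunctor P Q) (G : FibreFunctor Q R) : FibreFunctor P R where
  obj _ b V := G.obj b (F.obj b V)
  map _ _ b c V W f hf := G.map b c _ _ f (F.map b c V W f hf)

/-- Underlying objects and maps do not change, so once the object part is substituted only proofs
remain to be compared. -/
theorem functor_eq_id (F : FibreFunctor P P)
    (h : ∀ ⦃X : Type u⦄ (b : B.Str X) (V), F.obj b V = V) : F.functor = 𝟭 (Space P) := by
  obtain ⟨obj, map⟩ := F
  obtain rfl : obj = fun X b V => V := funext fun X => funext fun b => funext fun V => h b V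
  rfl

theorem faithful (F : FibreFunctor P Q) : F.functor.Faithful where
  map_injective {A A' f g} h := by
    have h1 : (F.functor.map f).toFun = (F.functor.map g).toFun := by rw [h]
    exact Space.Hom.ext h1

theorem full (F : FibreFunctor P Q)
    (h : ∀ ⦃X Y : Type u⦄ (b : B.Str X) (c : B.Str Y) (V : {V : VirtualStr B 𝒯 b // P b V})
      (W : {W : VirtualStr B 𝒯 c // P c W}) (f : X → Y),
      IsMor (F.obj b V).1 (F.obj c W).1 f → IsMor V.1 W.1 f) : F.functor.Full where
  map_surjective {A A'} g :=
    ⟨⟨g.toFun, h A.base A'.base ⟨A.str, A.prop⟩ ⟨A'.str, A'.prop⟩ g.toFun g.isMor⟩, rfl⟩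

/-- A fibre functor with a left inverse is full. -/
theorem full_of_leftInverse (F : FibreFunctor P Q) (G : FibreFunctor Q P)
    (h : ∀ ⦃X : Type u⦄ (b : B.Str X) (V), G.obj b (F.obj b V) = V) : F.functor.Full :=
  F.full fun X Y b c V W f hf => by
    have := G.map b c _ _ f hf
    rwa [h, h] at this

/-- An adjunction whose unit and counit are given by identity maps. -/
def adjunction (F : FibreFunctor P Q) (G : FibreFunctor Q P)
    (hu : ∀ ⦃X : Type u⦄ (b : B.Str X) (V), V ≤ G.obj b (F.obj b V))
    (hc : ∀ ⦃X : Type u⦄ (b : B.Str X) (W), F.obj b (G.obj b W) ≤ W) :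
    F.functor ⊣ G.functor :=
  Adjunction.mkOfUnitCounit
    { unit := { app := fun A => ⟨id, isMor_id_of_le (hu A.base ⟨A.str, A.prop⟩)⟩ }
      counit := { app := fun A => ⟨id, isMor_id_of_le (hc A.base ⟨A.str, A.prop⟩)⟩ } }

/-- Restriction to a smaller test category. -/
def restriction (P : Condition B 𝒯) (Q : Condition B 𝒮) (h : 𝒮 ⊆ 𝒯)
    (hPQ : ∀ ⦃X : Type u⦄ (b : B.Str X) (V : VirtualStr B 𝒯 b), P b V → Q b (V.restrict h)) :
    FibreFunctor P Q where
  obj _ b V := ⟨V.1.restrict h, hPQ b V.1 V.2⟩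
  map _ _ _ _ _ _ _ hf := ⟨hf.1, fun S => hf.2.1 ⟨S.1, h S.2⟩, fun S => hf.2.2 ⟨S.1, h S.2⟩⟩

/-- Inclusion of full subcategories defined by conditions. -/
def inclusion (P Q : Condition B 𝒯)
    (hPQ : ∀ ⦃X : Type u⦄ (b : B.Str X) (V : VirtualStr B 𝒯 b), P b V → Q b V) :
    FibreFunctor P Q where
  obj _ b V := ⟨V.1, hPQ b V.1 V.2⟩
  map _ _ _ _ _ _ _ hf := hf

theorem full_inclusion (P Q : Condition B 𝒯)
    (hPQ : ∀ ⦃X : Type u⦄ (b : B.Str X) (V : VirtualStr B 𝒯 b), P b V → Q b V) :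
    (inclusion P Q hPQ).functor.Full :=
  full _ fun _ _ _ _ _ _ _ hf => hf

/-- An extension functor which is both the join and the meet extension is inverse to restriction
on the left. -/
theorem extension_restriction {h : 𝒮 ⊆ 𝒯} {F : FibreFunctor P Q} {E : FibreFunctor Q P}
    (hF : F.IsRestriction h) (hj : E.IsJoinExtension h) (hm : E.IsMeetExtension h)
    ⦃X : Type u⦄ (b : B.Str X) (V) : E.obj b (F.obj b V) = V := by
  refine le_antisymm ((hm X b _).1 ?_) ((hj X b _).1 ?_)
  · exact (hF X b V).le
  · exact (hF X b V).ge

/-- If the extension of each structure restricts to that structure and is both the largest and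
the smallest one, then restriction and extension are mutually inverse. -/
theorem isRestrictionExtensionIso {h : 𝒮 ⊆ 𝒯} {F : FibreFunctor P Q} {E : FibreFunctor Q P}
    (hF : F.IsRestriction h) (hj : E.IsJoinExtension h) (hm : E.IsMeetExtension h)
    (hr : ∀ ⦃X : Type u⦄ (b : B.Str X) (V), F.obj b (E.obj b V) = V) :
    F.IsRestrictionExtensionIso E h :=
  ⟨hF, hj, hm, functor_eq_id (F.comp E) (extension_restriction hF hj hm),
    functor_eq_id (E.comp F) hr⟩

end FibreFunctor

end

end

/-! ### Structures saturated on both sides: Frölicher, Smith and Sikorski spaces. -/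

section

/-- The real line as a member of the test category which it forms. -/
def lineTest : lineTests := ⟨realLine, rfl⟩

section

variable {B : Underlying.{u}} {𝒯 : Set TestSpace}

theorem VirtualStr.le_of_subset {X : Type u} {b : B.Str X} {V W : VirtualStr B 𝒯 b}
    (hi : ∀ S, V.inp S ⊆ W.inp S) (ho : ∀ T, W.out T ⊆ V.out T) : V ≤ W :=
  ⟨hi, ho⟩

theorem VirtualStr.restrict_mono {𝒮 : Set TestSpace} (h : 𝒮 ⊆ 𝒯) {X : Type u} {b : B.Str X}
    {V W : VirtualStr B 𝒯 b} (hVW : V ≤ W) : V.restrict h ≤ W.restrict h :=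
  VirtualStr.le_of_subset (fun S => hVW.1 ⟨S.1, h S.2⟩) fun T => hVW.2 ⟨T.1, h T.2⟩

/-- Testing with the line loses nothing: outputs are tested through their coordinates, and inputs
through the smooth curves in their source. -/
theorem restrict_line_satisfies (hl : lineTests ⊆ 𝒯)
    (hd : ∀ S ∈ 𝒯, CurveDetermined S) ⦃X : Type u⦄ (b : B.Str X) (V : VirtualStr B 𝒯 b)
    (hV : (InSat ⊓ OutSat : Condition B 𝒯) b V) :
    (InSat ⊓ OutSat : Condition B lineTests) b (V.restrict hl) := by
  refine ⟨fun S i hi h => hV.1 ⟨S.1, hl S.2⟩ i hi fun T o ho => ?_,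
    fun T o ho h => hV.2 ⟨T.1, hl T.2⟩ o ho fun S i hi => ?_⟩
  · exact isSmooth_of_coordinates fun j => h lineTest _
      (V.out_comp (T := ⟨realLine, hl rfl⟩) (isSmooth_coordinate T.1 j) ho)
  · exact hd _ S.2 fun c hc => h lineTest _ (V.inp_comp (S := ⟨realLine, hl rfl⟩) hc hi)

/-- The structure with all test maps which are smooth along the given curves and functionals. -/
def lineExtension (hB : B.IsRegular) (hd : ∀ S ∈ 𝒯, CurveDetermined S) {X : Type u} {b : B.Str X}
    (V : VirtualStr B lineTests b) (hV : InSat b V) : VirtualStr B 𝒯 b where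
  inp S := {i | i ∈ B.inMor b S.1 ∧ ∀ L, ∀ o ∈ V.out L, IsSmooth (o ∘ i)}
  out T := {o | o ∈ B.outMor b T.1 ∧ ∀ L, ∀ c ∈ V.inp L, IsSmooth (o ∘ c)}
  inp_mor _ _ hi := hi.1
  out_mor _ _ ho := ho.1
  inp_comp hf hi := ⟨hB.in_comp hf hi.1, fun L o ho => (hi.2 L o ho).comp hf⟩
  out_comp hf ho := ⟨hB.out_comp hf ho.1, fun L _ hc => hf.comp (ho.2 L _ hc)⟩
  -- For each smooth curve `c` in the source, `i ∘ c` is a curve of `V` by input saturation. Hence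
  -- `o ∘ i` is smooth along all curves.
  compat {S _ _ _} hi ho := hd _ S.2 fun _ hc => ho.2 lineTest _
    (hV lineTest _ (hB.in_comp hc hi.1) fun L o' ho' => (hi.2 L o' ho').comp hc)

theorem lineExtension_satisfies (hB : B.IsRegular) (hl : lineTests ⊆ 𝒯)
    (hd : ∀ S ∈ 𝒯, CurveDetermined S) {X : Type u} {b : B.Str X} (V : VirtualStr B lineTests b)
    (hV : InSat b V) :
    (InSat ⊓ OutSat : Condition B 𝒯) b (lineExtension hB hd V hV) := by
  refine ⟨fun S i hi h => ⟨hi, fun L o ho => ?_⟩, fun T o ho h => ⟨ho, fun L c hc => ?_⟩⟩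
  · exact h ⟨L.1, hl L.2⟩ o ⟨V.out_mor L ho, fun L' c hc => V.compat hc ho⟩
  · exact h ⟨L.1, hl L.2⟩ c ⟨V.inp_mor L hc, fun L' o ho => V.compat hc ho⟩

/-- Extension of structures on lines with both saturation conditions. -/
def lineExtensionFunctor (hB : B.IsRegular) (hl : lineTests ⊆ 𝒯)
    (hd : ∀ S ∈ 𝒯, CurveDetermined S) :
    FibreFunctor (InSat ⊓ OutSat : Condition B lineTests) (InSat ⊓ OutSat : Condition B 𝒯) where
  obj _ _ V := ⟨lineExtension hB hd V.1 V.2.1, lineExtension_satisfies hB hl hd V.1 V.2.1⟩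
  map _ _ _ _ _ _ _ hf := ⟨hf.1,
    fun _ _ hi => ⟨hB.mor_in hf.1 hi.1, fun L _ ho => hi.2 L _ (hf.2.2 L _ ho)⟩,
    fun _ _ ho => ⟨hB.mor_out hf.1 ho.1, fun L _ hc => ho.2 L _ (hf.2.1 L _ hc)⟩⟩

theorem restrict_lineExtension (hB : B.IsRegular) (hl : lineTests ⊆ 𝒯)
    (hd : ∀ S ∈ 𝒯, CurveDetermined S) {X : Type u} {b : B.Str X} (V : VirtualStr B lineTests b)
    (hV : (InSat ⊓ OutSat : Condition B lineTests) b V) :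
    (lineExtension hB hd V hV.1).restrict hl = V :=
  le_antisymm
    (VirtualStr.le_of_subset (fun S i hi => hV.1 S i hi.1 hi.2)
      fun T _ ho => ⟨V.out_mor T ho, fun _ _ hc => V.compat hc ho⟩)
    (VirtualStr.le_of_subset (fun S _ hi => ⟨V.inp_mor S hi, fun _ _ ho => V.compat hi ho⟩)
      fun T o ho => hV.2 T o ho.1 ho.2)

/-- Compatibility inside a competing structure bounds one of its families, the inputs for the join
and the outputs for the meet. Its own saturation then gives the reverse inclusion for the other
family. -/
theorem lineExtensionFunctor_iso (hB : B.IsRegular) (hl : lineTests ⊆ 𝒯)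
    (hd : ∀ S ∈ 𝒯, CurveDetermined S) :
    (FibreFunctor.restriction (InSat ⊓ OutSat : Condition B 𝒯) (InSat ⊓ OutSat) hl
      (restrict_line_satisfies hl hd)).IsRestrictionExtensionIso
      (lineExtensionFunctor hB hl hd) hl := by
  refine FibreFunctor.isRestrictionExtensionIso (fun _ _ _ => rfl) (fun X b V => ⟨?_, ?_⟩)
    (fun X b V => ⟨?_, ?_⟩) fun _ _ V => Subtype.ext (restrict_lineExtension hB hl hd V.1 V.2)
  · intro W hW
    have h1 (S i) (hi : i ∈ W.1.inp S) : i ∈ (lineExtension hB hd V.1 V.2.1).inp S :=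
      ⟨W.1.inp_mor S hi, fun L o ho => W.1.compat hi (hW.2 L ho)⟩
    exact ⟨h1, fun T o ho => W.2.2 T o ho.1 fun S i hi =>
      (lineExtension hB hd V.1 V.2.1).compat (h1 S i hi) ho⟩
  · exact fun W hW => hW (restrict_lineExtension hB hl hd V.1 V.2).le
  · intro W hW
    have h1 (T o) (ho : o ∈ W.1.out T) : o ∈ (lineExtension hB hd V.1 V.2.1).out T :=
      ⟨W.1.out_mor T ho, fun L c hc => W.1.compat (hW.1 L hc) ho⟩
    exact ⟨fun S i hi => W.2.1 S i hi.1 fun T o ho =>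
      (lineExtension hB hd V.1 V.2.1).compat hi (h1 T o ho), h1⟩
  · exact fun W hW => hW (restrict_lineExtension hB hl hd V.1 V.2).ge

/-- The structure with the given outputs and all inputs which are smooth along them. -/
def saturateInp (hB : B.IsRegular) {X : Type u} {b : B.Str X} (V : VirtualStr B 𝒯 b) :
    VirtualStr B 𝒯 b where
  inp S := {i | i ∈ B.inMor b S.1 ∧ ∀ T, ∀ o ∈ V.out T, IsSmooth (o ∘ i)}
  out := V.out
  inp_mor _ _ hi := hi.1
  out_mor := V.out_mor
  inp_comp hf hi := ⟨hB.in_comp hf hi.1, fun T o ho => (hi.2 T o ho).comp hf⟩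
  out_comp := V.out_comp
  compat {_ T _ _} hi ho := hi.2 T _ ho

theorem le_saturateInp (hB : B.IsRegular) {X : Type u} {b : B.Str X} (V : VirtualStr B 𝒯 b) :
    V ≤ saturateInp hB V :=
  ⟨fun S _ hi => ⟨V.inp_mor S hi, fun _ _ ho => V.compat hi ho⟩, fun _ => subset_rfl⟩

/-- More inputs put more conditions on a candidate output, so output saturation persists and a
single saturation step suffices. -/
theorem saturateInp_outSat (hB : B.IsRegular) {X : Type u} {b : B.Str X} {V : VirtualStr B 𝒯 b}
    (hV : OutSat b V) : OutSat b (saturateInp hB V) := fun T o ho h =>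
  hV T o ho fun S i hi => h S i ((le_saturateInp hB V).1 S hi)

theorem saturateInp_satisfies (hB : B.IsRegular) {X : Type u} {b : B.Str X}
    {V : VirtualStr B 𝒯 b} (hV : OutSat b V) :
    (InSat ⊓ OutSat : Condition B 𝒯) b (saturateInp hB V) :=
  ⟨fun _ _ hi h => ⟨hi, h⟩, saturateInp_outSat hB hV⟩

/-- The structure with the given inputs and all outputs which are smooth along them. -/
def saturateOut (hB : B.IsRegular) {X : Type u} {b : B.Str X} (V : VirtualStr B 𝒯 b) :
    VirtualStr B 𝒯 b where
  inp := V.inp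
  out T := {o | o ∈ B.outMor b T.1 ∧ ∀ S, ∀ i ∈ V.inp S, IsSmooth (o ∘ i)}
  inp_mor := V.inp_mor
  out_mor _ _ ho := ho.1
  inp_comp := V.inp_comp
  out_comp hf ho := ⟨hB.out_comp hf ho.1, fun S i hi => hf.comp (ho.2 S i hi)⟩
  compat {S _ _ _} hi ho := ho.2 S _ hi

theorem saturateOut_le (hB : B.IsRegular) {X : Type u} {b : B.Str X} (V : VirtualStr B 𝒯 b) :
    saturateOut hB V ≤ V :=
  ⟨fun _ => subset_rfl, fun T _ ho => ⟨V.out_mor T ho, fun _ _ hi => V.compat hi ho⟩⟩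

theorem saturateOut_satisfies (hB : B.IsRegular) {X : Type u} {b : B.Str X}
    {V : VirtualStr B 𝒯 b} (hV : InSat b V) :
    (InSat ⊓ OutSat : Condition B 𝒯) b (saturateOut hB V) :=
  ⟨fun S i hi h => hV S i hi fun T o ho => h T o ((saturateOut_le hB V).2 T ho),
    fun _ _ ho h => ⟨ho, h⟩⟩

/-- The meet forcing functor from output saturated structures to structures with both saturation
conditions. -/
def meetForcing (hB : B.IsRegular) (P : Condition B 𝒯)
    (hP : ∀ ⦃X : Type u⦄ (b : B.Str X) (V : VirtualStr B 𝒯 b), P b V → OutSat b V) :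
    FibreFunctor P (InSat ⊓ OutSat : Condition B 𝒯) where
  obj _ _ V := ⟨saturateInp hB V.1, saturateInp_satisfies hB (hP _ V.1 V.2)⟩
  map _ _ _ _ _ _ _ hf := ⟨hf.1,
    fun _ _ hi => ⟨hB.mor_in hf.1 hi.1, fun T _ ho => hi.2 T _ (hf.2.2 T _ ho)⟩, hf.2.2⟩

theorem isMeetForcing_meetForcing (hB : B.IsRegular) (P : Condition B 𝒯)
    (hP : ∀ ⦃X : Type u⦄ (b : B.Str X) (V : VirtualStr B 𝒯 b), P b V → OutSat b V) :
    (meetForcing hB P hP).IsMeetForcing := fun _ _ V =>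
  ⟨fun W hW => ⟨fun S i hi => W.2.1 S i hi.1 fun T o ho => hi.2 T o (hW.2 T ho), hW.2⟩,
    fun _ hW => hW (le_saturateInp hB V.1)⟩

/-- The join forcing functor from input saturated structures to structures with both saturation
conditions. -/
def joinForcing (hB : B.IsRegular) (P : Condition B 𝒯)
    (hP : ∀ ⦃X : Type u⦄ (b : B.Str X) (V : VirtualStr B 𝒯 b), P b V → InSat b V) :
    FibreFunctor P (InSat ⊓ OutSat : Condition B 𝒯) where
  obj _ _ V := ⟨saturateOut hB V.1, saturateOut_satisfies hB (hP _ V.1 V.2)⟩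
  map _ _ _ _ _ _ _ hf := ⟨hf.1, hf.2.1,
    fun _ _ ho => ⟨hB.mor_out hf.1 ho.1, fun S _ hi => ho.2 S _ (hf.2.1 S _ hi)⟩⟩

theorem isJoinForcing_joinForcing (hB : B.IsRegular) (P : Condition B 𝒯)
    (hP : ∀ ⦃X : Type u⦄ (b : B.Str X) (V : VirtualStr B 𝒯 b), P b V → InSat b V) :
    (joinForcing hB P hP).IsJoinForcing := fun _ _ V =>
  ⟨fun W hW => ⟨hW.1, fun T o ho => W.2.2 T o ho.1 fun S i hi => ho.2 S i (hW.1 S hi)⟩,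
    fun _ hW => hW (saturateOut_le hB V.1)⟩

theorem InSat.inSheaf {X : Type u} {b : B.Str X} {V : VirtualStr B 𝒯 b}
    (hV : InSat b V) : InSheaf b V := fun S i hi h => hV S i hi fun T o ho =>
  isSmooth_of_locally fun x => by
    obtain ⟨U, hU, hx, h𝒯, hUi⟩ := h x
    exact ⟨U, hU, hx, V.compat hUi ho⟩

theorem InSat.inTerm (h𝒯 : realLine ∈ 𝒯) {X : Type u} {b : B.Str X} {V : VirtualStr B 𝒯 b}
    (hV : InSat b V) : InTerm b V := fun S hS i hi => hV S i hi fun _ _ _ => by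
  have := hS.subsingleton h𝒯
  exact isSmooth_of_subsingleton _

theorem OutSat.outTerm (h𝒯 : realLine ∈ 𝒯) {X : Type u} {b : B.Str X} {V : VirtualStr B 𝒯 b}
    (hV : OutSat b V) : OutTerm b V := fun T hT o ho => hV T o ho fun _ _ _ => by
  have := hT.subsingleton h𝒯
  exact isSmooth_to_subsingleton _

theorem OutSat.outDetCoord (h : lineTests ⊆ 𝒯) {X : Type u} {b : B.Str X} {V : VirtualStr B 𝒯 b}
    (hV : OutSat b V) : OutDetCoord h b V := fun T o ho hj => hV T o ho fun _ _ hi =>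
  isSmooth_of_coordinates fun j => V.compat hi (hj j)

/-- Inputs are continuous, so an open set of `X` on which two maps agree pulls back to a relatively
open piece of the test space, where smoothness can be checked. -/
theorem OutSat.outSheaf {X : Type u} {b : topologicalSpaces.Str X}
    {V : VirtualStr topologicalSpaces 𝒯 b} (hV : OutSat b V) : OutSheaf b V := by
  intro T o ho h
  refine hV T o ho fun S i hi => isSmooth_of_locally fun x => ?_
  obtain ⟨U, hU, hxU, g, hg, e⟩ := h (i x)
  have hi' : @Continuous _ _ _ b i := V.inp_mor S hi
  obtain ⟨U', hU', hU''⟩ := isOpen_induced_iff.1 (@Continuous.isOpen_preimage _ _ _ b i hi' U hU)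
  have hmem (y : S.1) : (y : Euc S.1.dim) ∈ U' ↔ i y ∈ U := by
    have : y ∈ Subtype.val ⁻¹' U' ↔ y ∈ i ⁻¹' U := by rw [hU'']
    exact this
  refine ⟨U', hU', (hmem x).2 hxU, ?_⟩
  have h1 : (o ∘ i) ∘ cutIncl S.1 U' = (g ∘ i) ∘ cutIncl S.1 U' := funext fun y =>
    e _ ((hmem (cutIncl S.1 U' y)).1 y.2.2)
  rw [h1]
  exact (V.compat hi hg).comp (isSmooth_cutIncl _ _)

end

theorem frolicherOpen_souriau ⦃X : Type u⦄ (b : sets.Str X) (V : VirtualStr sets openTests b)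
    (hV : frolicherOpen b V) : souriau b V :=
  ⟨⟨hV.1.inSheaf, hV.1.inTerm (line_subset_open rfl)⟩, hV.2⟩

theorem smithEuclidean_sikorski ⦃X : Type u⦄ (b : topologicalSpaces.Str X)
    (V : VirtualStr topologicalSpaces euclideanTests b) (hV : smithEuclidean b V) : sikorski b V :=
  ⟨hV.1, ⟨hV.2.outSheaf, hV.2.outDetCoord _⟩, hV.2.outTerm (line_subset_euclidean rfl)⟩

/-- After cancelling restriction against extension, the unit is the restriction of an instance of
the universal property of the join, and the counit is `saturateOut_le`. -/
theorem smith_sikorski_main :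
    ∃ (resS : FibreFunctor smithEuclidean.{u} smith.{u})
      (extS : FibreFunctor smith.{u} smithEuclidean.{u})
      (incS : FibreFunctor smithEuclidean.{u} sikorski.{u})
      (joinS : FibreFunctor sikorski.{u} smithEuclidean.{u}),
      resS.IsRestrictionExtensionIso extS line_subset_euclidean ∧
      incS.IsInclusion ∧ joinS.IsJoinForcing ∧
      (extS.functor ⋙ incS.functor).Full ∧ (extS.functor ⋙ incS.functor).Faithful ∧
      Nonempty (extS.functor ⋙ incS.functor ⊣ joinS.functor ⋙ resS.functor) := by
  have hd (S : TestSpace) (hS : S ∈ euclideanTests) := curveDetermined_of_euclidean hS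
  let R : FibreFunctor smithEuclidean.{u} smith.{u} := FibreFunctor.restriction _ _
    line_subset_euclidean (restrict_line_satisfies _ hd)
  let E : FibreFunctor smith.{u} smithEuclidean.{u} :=
    lineExtensionFunctor isRegular_topologicalSpaces line_subset_euclidean hd
  let I : FibreFunctor smithEuclidean.{u} sikorski.{u} :=
    FibreFunctor.inclusion _ _ smithEuclidean_sikorski
  let J : FibreFunctor sikorski.{u} smithEuclidean.{u} :=
    joinForcing isRegular_topologicalSpaces sikorski fun _ _ _ h => h.1
  have hJ : J.IsJoinForcing := isJoinForcing_joinForcing _ _ _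
  have hiso : R.IsRestrictionExtensionIso E line_subset_euclidean :=
    lineExtensionFunctor_iso isRegular_topologicalSpaces line_subset_euclidean hd
  have hER := FibreFunctor.extension_restriction hiso.1 hiso.2.1 hiso.2.2.1
  have hRE ⦃X : Type u⦄ (b : topologicalSpaces.Str X) (V) : R.obj b (E.obj b V) = V :=
    Subtype.ext (restrict_lineExtension isRegular_topologicalSpaces line_subset_euclidean hd V.1 V.2)
  have hJI ⦃X : Type u⦄ (b : topologicalSpaces.Str X) (V) : V ≤ J.obj b (I.obj b V) :=
    (hJ X b (I.obj b V)).1 (le_refl V.1)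
  have hE := E.full_of_leftInverse R hRE
  have hI : I.functor.Full := FibreFunctor.full_inclusion _ _ _
  refine ⟨R, E, I, J, hiso, fun _ _ _ => rfl, hJ, inferInstance, (E.comp I).faithful,
    ⟨FibreFunctor.adjunction (E.comp I) (J.comp R) (fun X b V => ?_) fun X b W => ?_⟩⟩
  · have h1 : R.obj b (E.obj b V) ≤ R.obj b (J.obj b (I.obj b (E.obj b V))) :=
      VirtualStr.restrict_mono line_subset_euclidean (hJI b (E.obj b V))
    rwa [hRE] at h1
  · change I.obj b (E.obj b (R.obj b (J.obj b W))) ≤ W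
    rw [hER]
    exact saturateOut_le isRegular_topologicalSpaces W.1

end

/-! ### Souriau and Chen spaces: extension from open convex test spaces. -/

section

/-- Input sheaves with all points whose outputs are saturated. -/
abbrev diffeological (𝒯 : Set TestSpace) : Condition sets.{u} 𝒯 := InSheaf ⊓ InTerm ⊓ OutSat

/-- The open convex subsets of Euclidean spaces. -/
abbrev openConvexTests : Set TestSpace := openTests ∩ convexTests

theorem line_subset_openConvex : lineTests ⊆ openConvexTests := by
  rintro _ rfl; exact ⟨(isOpen_univ : IsOpen (Set.univ : Set (Euc 1))),
    (convex_univ : Convex ℝ (Set.univ : Set (Euc 1)))⟩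

theorem pointTest_mem_openConvex : pointTest ∈ openConvexTests := ⟨(isOpen_univ : IsOpen (Set.univ : Set (Euc 0))),
  (convex_univ : Convex ℝ (Set.univ : Set (Euc 0)))⟩

theorem exists_isOpen_preimage {S T : TestSpace} {f : S → T} (hf : IsSmooth f)
    {U : Set (Euc T.dim)} (hU : IsOpen U) : ∃ U' : Set (Euc S.dim), IsOpen U' ∧
      ∀ x : S, (x : Euc S.dim) ∈ U' ↔ (f x : Euc T.dim) ∈ U := by
  obtain ⟨U', h1, h2⟩ := isOpen_induced_iff.1 (hU.preimage (continuous_subtype_val.comp hf.continuous))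
  refine ⟨U', h1, fun x => ?_⟩
  have : x ∈ Subtype.val ⁻¹' U' ↔ x ∈ (Subtype.val ∘ f) ⁻¹' U := by rw [h2]
  exact this

section

variable {B : Underlying.{u}} {𝒯 : Set TestSpace} {X : Type u} {b : B.Str X}

theorem InTerm.const_mem {V : VirtualStr B 𝒯 b} (hV : InTerm b V) (hp : pointTest ∈ 𝒯) (S : 𝒯)
    {x : X} (hx : (fun _ => x) ∈ B.inMor b pointTest) : (fun _ => x) ∈ V.inp S :=
  V.inp_comp (T := ⟨pointTest, hp⟩) (isSmooth_const ⟨0, Set.mem_univ _⟩)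
    (hV ⟨pointTest, hp⟩ (isTerminalTest_pointTest 𝒯) hx)

theorem inTerm_of_const {V : VirtualStr B 𝒯 b} (h𝒯 : realLine ∈ 𝒯)
    (h : ∀ S x, (fun _ => x) ∈ V.inp S) : InTerm b V := fun S hS i _ => by
  have := hS.subsingleton h𝒯
  obtain ⟨s⟩ := hS.nonempty h𝒯
  rw [show i = fun _ => i s from funext fun t => congrArg i (Subsingleton.elim _ _)]
  exact h S _

end

section

variable {𝒯 : Set TestSpace}

/-- Output saturation is the delicate condition, as fewer inputs are left to test with. The smooth
curves remain, and they detect smoothness on every test space in `𝒯`. -/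
theorem restrict_diffeological (h : openConvexTests ⊆ 𝒯) (hd : ∀ S ∈ 𝒯, CurveDetermined S)
    ⦃X : Type u⦄ (b : sets.Str X) (V : VirtualStr sets 𝒯 b) (hV : diffeological 𝒯 b V) :
    diffeological openConvexTests b (V.restrict h) := by
  refine ⟨⟨fun S i hi hx => ?_, ?_⟩, fun T o ho ho' => ?_⟩
  · refine hV.1.1 ⟨S.1, h S.2⟩ i hi fun x => ?_
    obtain ⟨U, hU, hxU, hc, hm⟩ := hx x
    exact ⟨U, hU, hxU, h hc, hm⟩
  · exact inTerm_of_const (line_subset_openConvex rfl) fun S x =>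
      hV.1.2.const_mem (h pointTest_mem_openConvex) ⟨S.1, h S.2⟩ trivial
  · exact hV.2 ⟨T.1, h T.2⟩ o ho fun S i hi => hd _ S.2 fun c hc =>
      ho' ⟨realLine, line_subset_openConvex rfl⟩ _
        (V.inp_comp (S := ⟨realLine, h (line_subset_openConvex rfl)⟩) hc hi)

/-- Restriction of diffeological structures to open convex test spaces. -/
def restrictOpenConvex (h : openConvexTests ⊆ 𝒯) (hd : ∀ S ∈ 𝒯, CurveDetermined S) :
    FibreFunctor (diffeological.{u} 𝒯) (diffeological openConvexTests) :=
  FibreFunctor.restriction _ _ h (restrict_diffeological h hd)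

/-- The structure whose inputs are the maps which are inputs along all smooth maps from open
convex sets. -/
def probeExtension (hd : ∀ S ∈ 𝒯, CurveDetermined S) {X : Type u} {b : sets.Str X}
    (V : VirtualStr sets openConvexTests b) : VirtualStr sets 𝒯 b where
  inp S := {i | ∀ (C : openConvexTests) (f : C.1 → S.1), IsSmooth f → i ∘ f ∈ V.inp C}
  out T := {o | ∀ C, ∀ i ∈ V.inp C, IsSmooth (o ∘ i)}
  inp_mor _ _ _ := trivial
  out_mor _ _ _ := trivial
  inp_comp hf hi C _ hg := hi C _ (hf.comp hg)
  out_comp hf ho C i hi := hf.comp (ho C i hi)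
  compat {S _ _ _} hi ho := hd _ S.2 fun c hc =>
    ho _ _ (hi ⟨realLine, line_subset_openConvex rfl⟩ c hc)

/-- The structure whose inputs factor locally through inputs on open convex sets. -/
def germExtension (𝒯 : Set TestSpace) {X : Type u} {b : sets.Str X}
    (V : VirtualStr sets openConvexTests b) : VirtualStr sets 𝒯 b where
  inp S := {i | ∀ x : S.1, ∃ U : Set (Euc S.1.dim), IsOpen U ∧ (x : Euc S.1.dim) ∈ U ∧
    ∃ (C : openConvexTests) (f : S.1.cut U → C.1) (j : C.1 → X), IsSmooth f ∧ j ∈ V.inp C ∧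
      i ∘ cutIncl S.1 U = j ∘ f}
  out T := {o | ∀ C, ∀ i ∈ V.inp C, IsSmooth (o ∘ i)}
  inp_mor _ _ _ := trivial
  out_mor _ _ _ := trivial
  inp_comp {S _ f _} hf hi x := by
    obtain ⟨U, hU, hxU, C, g, j, hg, hj, e⟩ := hi (f x)
    obtain ⟨U', hU', hm⟩ := exists_isOpen_preimage hf hU
    refine ⟨U', hU', (hm x).2 hxU, C, g ∘ cutMk (f ∘ cutIncl S.1 U') fun y =>
      (hm (cutIncl S.1 U' y)).1 y.2.2, j, hg.comp (IsSmooth.codRestrict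
        (hf.comp (isSmooth_cutIncl _ _)) _), hj, ?_⟩
    funext y
    exact congrFun e (cutMk (f ∘ cutIncl S.1 U') (fun y => (hm (cutIncl S.1 U' y)).1 y.2.2) y)
  out_comp hf ho C i hi := hf.comp (ho C i hi)
  compat {S _ _ _} hi ho := isSmooth_of_locally fun x => by
    obtain ⟨U, hU, hxU, C, f, j, hf, hj, e⟩ := hi x
    refine ⟨U, hU, hxU, ?_⟩
    rw [Function.comp_assoc, e]
    exact (ho C j hj).comp hf

theorem mem_inp_probeExtension (hd : ∀ S ∈ 𝒯, CurveDetermined S) {X : Type u} {b : sets.Str X}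
    {V : VirtualStr sets openConvexTests b} {S : 𝒯} {i : S.1 → X} :
    i ∈ (probeExtension hd V).inp S ↔
      ∀ (C : openConvexTests) (f : C.1 → S.1), IsSmooth f → i ∘ f ∈ V.inp C := Iff.rfl

theorem mem_out_probeExtension (hd : ∀ S ∈ 𝒯, CurveDetermined S) {X : Type u} {b : sets.Str X}
    {V : VirtualStr sets openConvexTests b} {T : 𝒯} {o : X → T.1} :
    o ∈ (probeExtension hd V).out T ↔ ∀ C, ∀ i ∈ V.inp C, IsSmooth (o ∘ i) := Iff.rfl

theorem mem_inp_germExtension {X : Type u} {b : sets.Str X}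
    {V : VirtualStr sets openConvexTests b} {S : 𝒯} {i : S.1 → X} :
    i ∈ (germExtension 𝒯 V).inp S ↔ ∀ x : S.1, ∃ U : Set (Euc S.1.dim), IsOpen U ∧
      (x : Euc S.1.dim) ∈ U ∧ ∃ (C : openConvexTests) (f : S.1.cut U → C.1) (j : C.1 → X),
        IsSmooth f ∧ j ∈ V.inp C ∧ i ∘ cutIncl S.1 U = j ∘ f := Iff.rfl

theorem mem_out_germExtension {X : Type u} {b : sets.Str X}
    {V : VirtualStr sets openConvexTests b} {T : 𝒯} {o : X → T.1} :
    o ∈ (germExtension 𝒯 V).out T ↔ ∀ C, ∀ i ∈ V.inp C, IsSmooth (o ∘ i) := Iff.rfl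

theorem inp_subset_probeExtension (h : openConvexTests ⊆ 𝒯) (hd : ∀ S ∈ 𝒯, CurveDetermined S)
    {X : Type u} {b : sets.Str X} (V : VirtualStr sets openConvexTests b) (C : openConvexTests) :
    V.inp C ⊆ (probeExtension hd V).inp ⟨C.1, h C.2⟩ :=
  fun _ hi => (mem_inp_probeExtension hd).2 fun _ _ hf => V.inp_comp hf hi

theorem inp_subset_germExtension (h : openConvexTests ⊆ 𝒯)
    {X : Type u} {b : sets.Str X} (V : VirtualStr sets openConvexTests b) (C : openConvexTests) :
    V.inp C ⊆ (germExtension 𝒯 V).inp ⟨C.1, h C.2⟩ :=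
  fun i hi => mem_inp_germExtension.2 fun _ => ⟨Set.univ, isOpen_univ, Set.mem_univ _, C, cutIncl C.1 Set.univ, i,
    isSmooth_cutIncl _ _, hi, rfl⟩

theorem restrict_probeExtension (h : openConvexTests ⊆ 𝒯) (hd : ∀ S ∈ 𝒯, CurveDetermined S)
    {X : Type u} {b : sets.Str X} (V : VirtualStr sets openConvexTests b) (hV : OutSat b V) :
    (probeExtension hd V).restrict h = V :=
  le_antisymm
    (VirtualStr.le_of_subset (fun S _ hi => (mem_inp_probeExtension hd).1 hi S id (isSmooth_id _))
      fun _ _ ho => (mem_out_probeExtension hd).2 fun _ _ hi => V.compat hi ho)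
    (VirtualStr.le_of_subset (inp_subset_probeExtension h hd V) fun T o ho =>
      hV T o trivial ((mem_out_probeExtension hd).1 ho))

/-- Points of an open set have arbitrarily small open convex neighbourhoods, so local factorizations
are local inputs and the sheaf condition of `V` applies. -/
theorem restrict_germExtension (h : openConvexTests ⊆ 𝒯)
    {X : Type u} {b : sets.Str X} (V : VirtualStr sets openConvexTests b)
    (hV : diffeological openConvexTests b V) : (germExtension 𝒯 V).restrict h = V := by
  refine le_antisymm (VirtualStr.le_of_subset (fun S i hi => ?_)
      fun _ _ ho => mem_out_germExtension.2 fun _ _ hi => V.compat hi ho)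
    (VirtualStr.le_of_subset (inp_subset_germExtension h V) fun T o ho =>
      hV.2 T o trivial (mem_out_germExtension.1 ho))
  refine hV.1.1 S i trivial fun x => ?_
  obtain ⟨U, hU, hxU, C, f, j, hf, hj, e⟩ := hi x
  obtain ⟨W, hWU, hW, hxW, hc⟩ := exists_cut_open S.2.1 x hU hxU
  refine ⟨W, hW, hxW, hc, ?_⟩
  have h1 : (fun y : S.1.cut W => i ⟨y.1, y.2.1⟩) =
      j ∘ (f ∘ cutMk (cutIncl S.1 W) fun y => hWU y.2.2) :=
    funext fun y => congrFun e (cutMk (cutIncl S.1 W) (fun y => hWU y.2.2) y)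
  rw [h1]
  exact V.inp_comp (S := ⟨_, hc⟩) (hf.comp (IsSmooth.codRestrict (isSmooth_cutIncl _ _) _)) hj

theorem probeExtension_diffeological (h : openConvexTests ⊆ 𝒯)
    (hd : ∀ S ∈ 𝒯, CurveDetermined S) {X : Type u} {b : sets.Str X}
    (V : VirtualStr sets openConvexTests b) (hV : diffeological openConvexTests b V) :
    diffeological 𝒯 b (probeExtension hd V) := by
  refine ⟨⟨fun S i _ hi => (mem_inp_probeExtension hd).2 fun C f hf =>
    hV.1.1 C _ trivial fun x => ?_, ?_⟩, fun T o _ ho => (mem_out_probeExtension hd).2 fun C i hi => ?_⟩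
  · obtain ⟨U, hU, hxU, hc, hm⟩ := hi (f x)
    obtain ⟨U', hU', hm'⟩ := exists_isOpen_preimage hf hU
    obtain ⟨W, hWU, hW, hxW, hcW⟩ := exists_cut_open C.2.1 x hU' ((hm' x).2 hxU)
    exact ⟨W, hW, hxW, hcW, (mem_inp_probeExtension hd).1 hm ⟨C.1.cut W, hcW⟩
      (cutMk (f ∘ cutIncl C.1 W) fun y => (hm' (cutIncl C.1 W y)).1 (hWU y.2.2))
      (IsSmooth.codRestrict (hf.comp (isSmooth_cutIncl _ _)) _)⟩
  · exact inTerm_of_const (h (line_subset_openConvex rfl)) fun S x => (mem_inp_probeExtension hd).2 fun C f _ =>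
      hV.1.2.const_mem pointTest_mem_openConvex C trivial
  · exact ho ⟨C.1, h C.2⟩ i (inp_subset_probeExtension h hd V C hi)

theorem germExtension_diffeological (h : openConvexTests ⊆ 𝒯) {X : Type u} {b : sets.Str X}
    (V : VirtualStr sets openConvexTests b) (hV : InTerm b V) :
    diffeological 𝒯 b (germExtension 𝒯 V) := by
  refine ⟨⟨fun S i _ hi => mem_inp_germExtension.2 fun x => ?_, ?_⟩,
    fun T o _ ho => mem_out_germExtension.2 fun C i hi => ?_⟩
  · obtain ⟨U, hU, hxU, hc, hm⟩ := hi x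
    obtain ⟨U', hU', hxU', C, f, j, hf, hj, e⟩ := mem_inp_germExtension.1 hm ⟨x.1, x.2, hxU⟩
    let g : S.1.cut (U ∩ U') → (S.1.cut U).cut U' := fun y => ⟨y.1, ⟨y.2.1, y.2.2.1⟩, y.2.2.2⟩
    have hg : IsSmooth g := isSmooth_of_contDiff (S := S.1.cut (U ∩ U')) id contDiff_id fun _ => rfl
    exact ⟨U ∩ U', hU.inter hU', ⟨hxU, hxU'⟩, C, f ∘ g, j, hf.comp hg, hj,
      funext fun y => congrFun e (g y)⟩
  · exact inTerm_of_const (h (line_subset_openConvex rfl)) fun S x =>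
      -- A constant map factors through the one-point test space.
      mem_inp_germExtension.2 fun y => ⟨Set.univ, isOpen_univ, Set.mem_univ _, ⟨pointTest, pointTest_mem_openConvex⟩,
        fun _ => ⟨0, Set.mem_univ _⟩, fun _ => x, isSmooth_const _,
        hV.const_mem pointTest_mem_openConvex _ trivial, rfl⟩
  · exact ho ⟨C.1, h C.2⟩ i (inp_subset_germExtension h V C hi)

/-- Join extension from open convex test spaces. -/
def joinExtension (h : openConvexTests ⊆ 𝒯) (hd : ∀ S ∈ 𝒯, CurveDetermined S) :
    FibreFunctor (diffeological.{u} openConvexTests) (diffeological 𝒯) where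
  obj _ _ V := ⟨probeExtension hd V.1, probeExtension_diffeological h hd V.1 V.2⟩
  map _ _ _ _ _ _ _ hf := ⟨trivial,
    fun _ _ hi => (mem_inp_probeExtension hd).2 fun C g hg =>
      hf.2.1 C _ ((mem_inp_probeExtension hd).1 hi C g hg),
    fun _ _ ho => (mem_out_probeExtension hd).2 fun C _ hi =>
      (mem_out_probeExtension hd).1 ho C _ (hf.2.1 C _ hi)⟩

/-- Meet extension from open convex test spaces. -/
def meetExtension (h : openConvexTests ⊆ 𝒯) :
    FibreFunctor (diffeological.{u} openConvexTests) (diffeological 𝒯) where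
  obj _ _ V := ⟨germExtension 𝒯 V.1, germExtension_diffeological h V.1 V.2.1.2⟩
  map _ _ _ _ _ _ k hf := ⟨trivial, fun _ _ hi => mem_inp_germExtension.2 fun x => by
      obtain ⟨U, hU, hxU, C, f, j, hf', hj, e⟩ := mem_inp_germExtension.1 hi x
      exact ⟨U, hU, hxU, C, f, k ∘ j, hf', hf.2.1 C _ hj,
        funext fun y => congrArg k (congrFun e y)⟩,
    fun _ _ ho => mem_out_germExtension.2 fun C _ hi =>
      mem_out_germExtension.1 ho C _ (hf.2.1 C _ hi)⟩

/-- Inputs of a competitor, composed with smooth maps from open convex sets, are inputs of its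
restriction and so of `V`. -/
theorem isJoinExtension_joinExtension (h : openConvexTests ⊆ 𝒯)
    (hd : ∀ S ∈ 𝒯, CurveDetermined S) :
    (joinExtension.{u} h hd).IsJoinExtension h := by
  refine fun X b V => ⟨fun W hW => ?_, fun W hW => hW (restrict_probeExtension h hd V.1 V.2.2).le⟩
  have h1 (S i) (hi : i ∈ W.1.inp S) : i ∈ (probeExtension hd V.1).inp S :=
    (mem_inp_probeExtension hd).2 fun C f hf => hW.1 C (W.1.inp_comp (S := ⟨C.1, h C.2⟩) hf hi)
  exact ⟨h1, fun T o ho => W.2.2 T o trivial fun S i hi =>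
    (probeExtension hd V.1).compat (h1 S i hi) ho⟩

/-- A competitor contains the inputs of `V`, hence all maps factoring through them. Since small
pieces of test spaces are again in `𝒯`, its sheaf condition yields the maps that factor locally. -/
theorem isMeetExtension_meetExtension (h : openConvexTests ⊆ 𝒯)
    (hc : ∀ S ∈ 𝒯, ∀ (x : S) (U : Set (Euc S.dim)), IsOpen U → (x : Euc S.dim) ∈ U →
      ∃ V ⊆ U, IsOpen V ∧ (x : Euc S.dim) ∈ V ∧ S.cut V ∈ 𝒯) :
    (meetExtension.{u} h).IsMeetExtension h := by
  refine fun X b V => ⟨fun W hW => ⟨fun S i hi => ?_, fun T o ho =>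
    mem_out_germExtension.2 fun C i hi => W.1.compat (hW.1 C hi) ho⟩, fun W hW => hW (restrict_germExtension h V.1 V.2).ge⟩
  refine W.2.1.1 S i trivial fun x => ?_
  obtain ⟨U, hU, hxU, C, f, j, hf, hj, e⟩ := hi x
  obtain ⟨U', hU'U, hU', hxU', hc'⟩ := hc S.1 S.2 x U hU hxU
  refine ⟨U', hU', hxU', hc', ?_⟩
  have h1 : (fun y : S.1.cut U' => i ⟨y.1, y.2.1⟩) =
      j ∘ (f ∘ cutMk (cutIncl S.1 U') fun y => hU'U y.2.2) :=
    funext fun y => congrFun e (cutMk (cutIncl S.1 U') (fun y => hU'U y.2.2) y)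
  rw [h1]
  exact W.1.inp_comp (S := ⟨_, hc'⟩) (T := ⟨C.1, h C.2⟩)
    (hf.comp (IsSmooth.codRestrict (isSmooth_cutIncl _ _) _)) (hW.1 C hj)

/-- If every test space is covered by open convex pieces, their inclusions are themselves probes, so
the largest extension is also the smallest. A half-line, at its end point, violates this hypothesis.
-/
theorem isMeetExtension_joinExtension (h : openConvexTests ⊆ 𝒯)
    (hd : ∀ S ∈ 𝒯, CurveDetermined S)
    (hc : ∀ S ∈ 𝒯, ∀ (x : S) (U : Set (Euc S.dim)), IsOpen U → (x : Euc S.dim) ∈ U →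
      ∃ V ⊆ U, IsOpen V ∧ (x : Euc S.dim) ∈ V ∧ S.cut V ∈ openConvexTests) :
    (joinExtension.{u} h hd).IsMeetExtension h := by
  refine fun X b V => ⟨fun W hW => ⟨fun S i hi => ?_, fun T o ho =>
    (mem_out_probeExtension hd).2 fun C i hi => W.1.compat (hW.1 C hi) ho⟩,
    fun W hW => hW (restrict_probeExtension h hd V.1 V.2.2).ge⟩
  refine W.2.1.1 S i trivial fun x => ?_
  obtain ⟨U, -, hU, hxU, hc'⟩ := hc S.1 S.2 x Set.univ isOpen_univ (Set.mem_univ _)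
  exact ⟨U, hU, hxU, h hc', hW.1 ⟨_, hc'⟩
    ((mem_inp_probeExtension hd).1 hi ⟨_, hc'⟩ (cutIncl S.1 U) (isSmooth_cutIncl _ _))⟩

end

/-- Restriction to open convex tests undoes both extensions to Chen spaces. This gives fullness, and
it turns the unit of one Chen adjunction and the counit of the other into equalities; the remaining
inequalities are the universal properties of meet and join. -/
theorem frolicher_souriau_chen_main :
    ∃ (resF : FibreFunctor frolicherOpen.{u} frolicher.{u})
      (extF : FibreFunctor frolicher.{u} frolicherOpen.{u})
      (resD : FibreFunctor souriau.{u} souriauConvex.{u})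
      (extD : FibreFunctor souriauConvex.{u} souriau.{u})
      (incF : FibreFunctor frolicherOpen.{u} souriau.{u})
      (meetF : FibreFunctor souriau.{u} frolicherOpen.{u})
      (resC : FibreFunctor chen.{u} souriauConvex.{u})
      (meetC joinC : FibreFunctor souriauConvex.{u} chen.{u}),
      resF.IsRestrictionExtensionIso extF line_subset_open ∧
      resD.IsRestrictionExtensionIso extD Set.inter_subset_left ∧
      incF.IsInclusion ∧ meetF.IsMeetForcing ∧
      (extF.functor ⋙ incF.functor).Full ∧ (extF.functor ⋙ incF.functor).Faithful ∧
      Nonempty (meetF.functor ⋙ resF.functor ⊣ extF.functor ⋙ incF.functor) ∧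
      resC.IsRestriction Set.inter_subset_right ∧
      meetC.IsMeetExtension Set.inter_subset_right ∧
      joinC.IsJoinExtension Set.inter_subset_right ∧
      (resD.functor ⋙ meetC.functor).Full ∧ (resD.functor ⋙ meetC.functor).Faithful ∧
      (resD.functor ⋙ joinC.functor).Full ∧ (resD.functor ⋙ joinC.functor).Faithful ∧
      Nonempty (resD.functor ⋙ meetC.functor ⊣ resC.functor ⋙ extD.functor) ∧
      Nonempty (resC.functor ⋙ extD.functor ⊣ resD.functor ⋙ joinC.functor) := by
  have hdO (S : TestSpace) (hS : S ∈ openTests) : CurveDetermined S := curveDetermined_of_open hS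
  have hdC (S : TestSpace) (hS : S ∈ convexTests) : CurveDetermined S :=
    curveDetermined_of_convex hS
  have hcO (S : TestSpace) (hS : S ∈ openTests) (x : S) (U : Set (Euc S.dim)) :=
    exists_cut_open hS x (U := U)
  have hcC (S : TestSpace) (hS : S ∈ convexTests) (x : S) (U : Set (Euc S.dim)) :=
    exists_cut_convex hS x (U := U)
  have hl : openConvexTests ⊆ openTests := Set.inter_subset_left
  have hr : openConvexTests ⊆ convexTests := Set.inter_subset_right
  let resF : FibreFunctor frolicherOpen.{u} frolicher.{u} := FibreFunctor.restriction _ _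
    line_subset_open (restrict_line_satisfies _ hdO)
  let extF : FibreFunctor frolicher.{u} frolicherOpen.{u} :=
    lineExtensionFunctor isRegular_sets line_subset_open hdO
  let resD : FibreFunctor souriau.{u} souriauConvex.{u} := restrictOpenConvex hl hdO
  let extD : FibreFunctor souriauConvex.{u} souriau.{u} := joinExtension hl hdO
  let incF : FibreFunctor frolicherOpen.{u} souriau.{u} :=
    FibreFunctor.inclusion _ _ frolicherOpen_souriau
  let meetF : FibreFunctor souriau.{u} frolicherOpen.{u} :=
    meetForcing isRegular_sets souriau fun _ _ _ h => h.2
  let resC : FibreFunctor chen.{u} souriauConvex.{u} := restrictOpenConvex hr hdC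
  let meetC : FibreFunctor souriauConvex.{u} chen.{u} := meetExtension hr
  let joinC : FibreFunctor souriauConvex.{u} chen.{u} := joinExtension hr hdC
  have hF : resF.IsRestrictionExtensionIso extF line_subset_open :=
    lineExtensionFunctor_iso isRegular_sets line_subset_open hdO
  have hresextF ⦃X : Type u⦄ (b : sets.Str X) (V) : resF.obj b (extF.obj b V) = V :=
    Subtype.ext (restrict_lineExtension isRegular_sets line_subset_open hdO V.1 V.2)
  have hextresF := FibreFunctor.extension_restriction hF.1 hF.2.1 hF.2.2.1
  have hresextD ⦃X : Type u⦄ (b : sets.Str X) (V) : resD.obj b (extD.obj b V) = V :=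
    Subtype.ext (restrict_probeExtension hl hdO V.1 V.2.2)
  have hD : resD.IsRestrictionExtensionIso extD hl :=
    FibreFunctor.isRestrictionExtensionIso (fun _ _ _ => rfl)
      (isJoinExtension_joinExtension hl hdO)
      (isMeetExtension_joinExtension hl hdO fun S hS x U hU hx => hcO S hS x U hU hx) hresextD
  have hextresD := FibreFunctor.extension_restriction hD.1 hD.2.1 hD.2.2.1
  have hmeetF : meetF.IsMeetForcing := isMeetForcing_meetForcing _ _ _
  have hmeetC : meetC.IsMeetExtension hr := isMeetExtension_meetExtension hr hcC
  have hjoinC : joinC.IsJoinExtension hr := isJoinExtension_joinExtension hr hdC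
  have hresmeet ⦃X : Type u⦄ (b : sets.Str X) (V) : resC.obj b (meetC.obj b V) = V :=
    Subtype.ext (restrict_germExtension hr V.1 V.2)
  have hresjoin ⦃X : Type u⦄ (b : sets.Str X) (V) : resC.obj b (joinC.obj b V) = V :=
    Subtype.ext (restrict_probeExtension hr hdC V.1 V.2.2)
  have : extF.functor.Full := extF.full_of_leftInverse resF hresextF
  have : incF.functor.Full := FibreFunctor.full_inclusion _ _ _
  have : resD.functor.Full := resD.full_of_leftInverse extD hextresD
  have : meetC.functor.Full := meetC.full_of_leftInverse resC hresmeet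
  have : joinC.functor.Full := joinC.full_of_leftInverse resC hresjoin
  refine ⟨resF, extF, resD, extD, incF, meetF, resC, meetC, joinC, hF, hD, fun _ _ _ => rfl, hmeetF,
    inferInstance, (extF.comp incF).faithful,
    ⟨FibreFunctor.adjunction (meetF.comp resF) (extF.comp incF) (fun X b V => ?_)
      fun X b W => ?_⟩, fun _ _ _ => rfl, hmeetC, hjoinC,
    inferInstance, (resD.comp meetC).faithful, inferInstance, (resD.comp joinC).faithful,
    ⟨FibreFunctor.adjunction (resD.comp meetC) (resC.comp extD) (fun X b V => ?_)
      fun X b W => ?_⟩,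
    ⟨FibreFunctor.adjunction (resC.comp extD) (resD.comp joinC) (fun X b V => ?_)
      fun X b W => ?_⟩⟩
  · change V ≤ incF.obj b (extF.obj b (resF.obj b (meetF.obj b V)))
    rw [hextresF]
    exact le_saturateInp isRegular_sets V.1
  · have h1 : meetF.obj b (incF.obj b (extF.obj b W)) ≤ extF.obj b W :=
      (hmeetF X b _).1 (le_refl (extF.obj b W).1)
    have h2 : resF.obj b (meetF.obj b (incF.obj b (extF.obj b W))) ≤
        resF.obj b (extF.obj b W) := VirtualStr.restrict_mono line_subset_open h1
    rwa [hresextF] at h2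
  · change V ≤ extD.obj b (resC.obj b (meetC.obj b (resD.obj b V)))
    rw [hresmeet, hextresD]
  · change meetC.obj b (resD.obj b (extD.obj b (resC.obj b W))) ≤ W
    rw [hresextD]
    exact (hmeetC X b _).1 (le_refl (W.1.restrict hr))
  · change V ≤ joinC.obj b (resD.obj b (extD.obj b (resC.obj b V)))
    rw [hresextD]
    exact (hjoinC X b _).1 (le_refl (V.1.restrict hr))
  · change extD.obj b (resC.obj b (joinC.obj b (resD.obj b W))) ≤ W
    rw [hresjoin, hextresD]

end

section

/-! ### Frölicher spaces as Smith spaces -/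

theorem smith_curves_eq (A : Space frolicher.{u}) (S : lineTests) :
    {i : S.1 → A.carrier | ∀ T, ∀ o ∈ A.str.out T, IsSmooth (o ∘ i)} = A.str.inp S :=
  Set.Subset.antisymm (fun i hi => A.prop.1 S i trivial hi) fun _ hi _ _ ho => A.str.compat hi ho

/-- The round trip through Smith spaces, with the curvaceous topology. -/
def curvaceousRoundTrip : FibreFunctor frolicher.{u} frolicher.{u} where
  obj X b V :=
    let A := (frolicherToSmithCurvaceous ⋙ smithToFrolicher).obj ⟨X, b, V.1, V.2⟩
    ⟨A.str, A.prop⟩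
  map X Y b c V W f hf := ((frolicherToSmithCurvaceous ⋙ smithToFrolicher).map
    (X := ⟨X, b, V.1, V.2⟩) (Y := ⟨Y, c, W.1, W.2⟩) ⟨f, hf⟩).isMor

/-- The round trip through Smith spaces, with the functional topology. -/
def functionalRoundTrip : FibreFunctor frolicher.{u} frolicher.{u} where
  obj X b V :=
    let A := (frolicherToSmithFunctional ⋙ smithToFrolicher).obj ⟨X, b, V.1, V.2⟩
    ⟨A.str, A.prop⟩
  map X Y b c V W f hf := ((frolicherToSmithFunctional ⋙ smithToFrolicher).map
    (X := ⟨X, b, V.1, V.2⟩) (Y := ⟨Y, c, W.1, W.2⟩) ⟨f, hf⟩).isMor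

/-- The Smith space keeps the functionals, which by saturation determine the curves, and these the
functionals. The topology plays no role, so both embeddings are covered. -/
theorem frolicher_eq_of_saturated {X : Type u} {b : sets.Str X} {V W : VirtualStr sets lineTests b}
    (hV : frolicher b V)
    (hi : ∀ S, W.inp S = {i | ∀ T, ∀ o ∈ V.out T, IsSmooth (o ∘ i)})
    (ho : ∀ T, W.out T = {o | ∀ (S : lineTests) (i : S.1 → X),
      (∀ T', ∀ o' ∈ V.out T', IsSmooth (o' ∘ i)) → IsSmooth (o ∘ i)}) : W = V := by
  have h1 (S : lineTests) : W.inp S = V.inp S :=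
    (hi S).trans (smith_curves_eq ⟨X, b, V, hV⟩ S)
  refine VirtualStr.ext (funext h1) (funext fun T => (ho T).trans (Set.Subset.antisymm ?_ ?_))
  · exact fun o h => hV.2 T o trivial fun S i hi => h S i fun T' o' ho' => V.compat hi ho'
  · exact fun o h S i hi => V.compat (hV.1 S i trivial hi) h

theorem frolicher_smith_main :
    frolicherToSmithCurvaceous.{u}.Full ∧ frolicherToSmithCurvaceous.{u}.Faithful ∧
      frolicherToSmithCurvaceous.{u} ⋙ smithToFrolicher = 𝟭 (Space frolicher.{u}) ∧
      frolicherToSmithFunctional.{u}.Full ∧ frolicherToSmithFunctional.{u}.Faithful ∧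
      frolicherToSmithFunctional.{u} ⋙ smithToFrolicher = 𝟭 (Space frolicher.{u}) := by
  refine ⟨⟨fun g => ⟨⟨g.toFun, trivial, g.isMor.2⟩, rfl⟩⟩, ⟨fun {A A' f g} h => ?_⟩, ?_,
    ⟨fun g => ⟨⟨g.toFun, trivial, g.isMor.2⟩, rfl⟩⟩, ⟨fun {A A' f g} h => ?_⟩, ?_⟩
  · have h1 : (frolicherToSmithCurvaceous.map f).toFun =
      (frolicherToSmithCurvaceous.map g).toFun := by rw [h]
    exact Space.Hom.ext h1
  · exact curvaceousRoundTrip.functor_eq_id fun X b V =>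
      Subtype.ext (frolicher_eq_of_saturated V.2 (fun _ => rfl) fun _ => rfl)
  · have h1 : (frolicherToSmithFunctional.map f).toFun =
      (frolicherToSmithFunctional.map g).toFun := by rw [h]
    exact Space.Hom.ext h1
  · exact functionalRoundTrip.functor_eq_id fun X b V =>
      Subtype.ext (frolicher_eq_of_saturated V.2 (fun _ => rfl) fun _ => rfl)

/-! ### The earlier categories of Chen spaces -/

theorem pointTest_mem_closedConvex : pointTest ∈ closedConvexTests :=
  ⟨(isClosed_univ : IsClosed (Set.univ : Set (Euc 0))),
    (convex_univ : Convex ℝ (Set.univ : Set (Euc 0)))⟩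

theorem curveDetermined_of_closedConvex (S : TestSpace) (hS : S ∈ closedConvexTests) :
    CurveDetermined S :=
  curveDetermined_of_convex hS.2

section

variable {𝒯 : Set TestSpace} {X : Type u} {b : topologicalSpaces.Str X}
  {V : VirtualStr topologicalSpaces 𝒯 b}

theorem continuous_out_comp_inp {S T : 𝒯} {i : S.1 → X} {o : X → T.1}
    (hi : i ∈ topologicalSpaces.inMor b S.1) (ho : o ∈ V.out T) :
    o ∘ i ∈ topologicalSpaces.{u}.testMor S.1 T.1 :=
  @Continuous.comp _ _ _ _ b _ _ _ (V.out_mor T ho) hi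

/-- Composites with outputs are continuous maps between test spaces, so the determining family can
be applied to them. -/
theorem InSat.inDet (hV : InSat b V) : InDet b V := fun S _ hF i hi ht =>
  hV S i hi fun T _ ho => hF.2 T _ (continuous_out_comp_inp hi ho) fun R t h =>
    V.compat (ht R t h) ho

end

theorem sat_chen1975b ⦃X : Type u⦄ (b : topologicalSpaces.Str X)
    (V : VirtualStr topologicalSpaces closedConvexTests b)
    (hV : (InSat ⊓ OutSat : Condition topologicalSpaces closedConvexTests) b V) :
    chen1975b b V :=
  ⟨⟨hV.1.inDet, hV.1.inTerm (line_subset_closedConvex rfl)⟩, hV.2⟩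

theorem chen1975b_chen1975a ⦃X : Type u⦄ (b : topologicalSpaces.Str X)
    (V : VirtualStr topologicalSpaces closedConvexTests b) (hV : chen1975b b V) : chen1975a b V :=
  ⟨hV.1.2, hV.2⟩

/-- The inputs of `V` which a map takes to inputs of `W`, among all maps which are smooth along
the outputs of `V`. -/
def pullbackInp {X Y : Type u} {b : topologicalSpaces.Str X} {c : topologicalSpaces.Str Y}
    (V : VirtualStr topologicalSpaces closedConvexTests b)
    (W : VirtualStr topologicalSpaces closedConvexTests c) (f : X → Y) :
    VirtualStr topologicalSpaces closedConvexTests b where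
  inp S := {i | i ∈ (saturateInp isRegular_topologicalSpaces V).inp S ∧ f ∘ i ∈ W.inp S}
  out := V.out
  inp_mor S _ hi := (saturateInp isRegular_topologicalSpaces V).inp_mor S hi.1
  out_mor := V.out_mor
  inp_comp hf hi := ⟨VirtualStr.inp_comp _ hf hi.1, W.inp_comp hf hi.2⟩
  out_comp := V.out_comp
  compat hi ho := VirtualStr.compat (saturateInp isRegular_topologicalSpaces V) hi.1 ho

/-- Being determined passes to preimages under `f` and to intersections. Intersecting with the
saturation of `V` keeps the outputs of `V` compatible. This is what makes the hull functorial. -/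
theorem pullbackInp_chen1975b {X Y : Type u} {b : topologicalSpaces.Str X}
    {c : topologicalSpaces.Str Y} {V : VirtualStr topologicalSpaces closedConvexTests b}
    {W : VirtualStr topologicalSpaces closedConvexTests c} {f : X → Y} (hV : chen1975a b V)
    (hW : chen1975b c W) (hf : IsMor V W f) :
    V ≤ pullbackInp V W f ∧ chen1975b b (pullbackInp V W f) := by
  have h1 : V ≤ pullbackInp V W f := VirtualStr.le_of_subset
    (fun S i hi => ⟨(le_saturateInp isRegular_topologicalSpaces V).1 S hi, hf.2.1 S i hi⟩)
    fun _ => subset_rfl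
  have h2 : chen1975b b (saturateInp isRegular_topologicalSpaces V) :=
    sat_chen1975b _ _ (saturateInp_satisfies isRegular_topologicalSpaces hV.2)
  refine ⟨h1, ⟨fun S F hF i hi ht => ⟨?_, ?_⟩, fun S hS i hi => h1.1 S (hV.1 S hS hi)⟩,
    fun T o ho h => hV.2 T o ho fun S i hi => h S i (h1.1 S hi)⟩
  · exact h2.1.1 S F hF i hi fun T t h => (ht T t h).1
  · exact hW.1.1 S F hF _ (isRegular_topologicalSpaces.mor_in hf.1 hi) fun T t h => (ht T t h).2

/-- The smallest structure above `V` with determined inputs. -/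
def determinedHull {X : Type u} {b : topologicalSpaces.Str X}
    (V : {V : VirtualStr topologicalSpaces closedConvexTests b // chen1975a b V}) :
    VirtualStr topologicalSpaces closedConvexTests b where
  inp S := {i | ∀ W : VirtualStr topologicalSpaces closedConvexTests b, chen1975b b W → V.1 ≤ W →
    i ∈ W.inp S}
  out := V.1.out
  -- The saturation of `V` is one of the structures intersected, which bounds the hull from above.
  inp_mor S _ hi := (saturateInp isRegular_topologicalSpaces V.1).inp_mor S
    (hi _ (sat_chen1975b _ _ (saturateInp_satisfies isRegular_topologicalSpaces V.2.2))
      (le_saturateInp _ _))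
  out_mor := V.1.out_mor
  inp_comp hf hi W hW hVW := W.inp_comp hf (hi W hW hVW)
  out_comp := V.1.out_comp
  compat hi ho := VirtualStr.compat (saturateInp isRegular_topologicalSpaces V.1)
    (hi _ (sat_chen1975b _ _ (saturateInp_satisfies isRegular_topologicalSpaces V.2.2))
      (le_saturateInp _ _)) ho

section

variable {X : Type u} {b : topologicalSpaces.Str X}
  (V : {V : VirtualStr topologicalSpaces closedConvexTests b // chen1975a b V})

theorem mem_inp_determinedHull {S : closedConvexTests} {i : S.1 → X} :
    i ∈ (determinedHull V).inp S ↔ ∀ W : VirtualStr topologicalSpaces closedConvexTests b,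
      chen1975b b W → V.1 ≤ W → i ∈ W.inp S := Iff.rfl

theorem le_determinedHull : V.1 ≤ determinedHull V :=
  VirtualStr.le_of_subset
    (fun S _ hi => (mem_inp_determinedHull V).2 fun _ _ hVW => hVW.1 S hi) fun _ => subset_rfl

theorem determinedHull_chen1975b : chen1975b b (determinedHull V) := by
  refine ⟨⟨fun S F hF i hi ht => (mem_inp_determinedHull V).2 fun W hW hVW =>
    hW.1.1 S F hF i hi fun T t h => (mem_inp_determinedHull V).1 (ht T t h) W hW hVW,
    fun S hS i hi => (le_determinedHull V).1 S (V.2.1 S hS hi)⟩,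
    fun T o ho h => V.2.2 T o ho fun S i hi => h S i ((le_determinedHull V).1 S hi)⟩

end

/-- The left adjoint of the inclusion of the third in the second category of Chen spaces. -/
def determinedHullFunctor : FibreFunctor chen1975a.{u} chen1975b.{u} where
  obj _ _ V := ⟨determinedHull V, determinedHull_chen1975b V⟩
  map X Y b c V W f hf := ⟨hf.1, fun S i hi => (mem_inp_determinedHull W).2 fun U hU hWU => by
      -- Each `U` above `W` pulls back along `f` to a determined structure above `V`, and the latter
      -- contains the hull of `V`.
      have h1 : IsMor V.1 U f := ⟨hf.1, fun S i hi => hWU.1 S (hf.2.1 S i hi),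
        fun S o ho => hf.2.2 S o (hWU.2 S ho)⟩
      obtain ⟨h2, h3⟩ := pullbackInp_chen1975b V.2 hU h1
      exact ((mem_inp_determinedHull V).1 hi _ h3 h2).2, hf.2.2⟩

theorem outSat_restrict_line ⦃X : Type u⦄ (b : topologicalSpaces.Str X)
    (V : VirtualStr topologicalSpaces closedConvexTests b) (hV : chen1975b b V) :
    OutSat b (V.restrict line_subset_closedConvex) := fun T o ho h =>
  hV.2 ⟨T.1, line_subset_closedConvex T.2⟩ o ho fun S _ hi =>
    curveDetermined_of_closedConvex _ S.2 fun _ hc => h lineTest _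
      (V.inp_comp (S := ⟨realLine, line_subset_closedConvex rfl⟩) hc hi)

/-- The largest Hausdorff quotient, with the inputs and outputs of the quotient. -/
def hausdorffQuotient (A : Space chen1975a.{u}) : Space chen1973.{u} :=
  letI : TopologicalSpace A.carrier := A.base
  { carrier := T2Quotient A.carrier
    base := ⟨inferInstance, inferInstance⟩
    str :=
      -- Inputs that lift suffice, because neither a sheaf nor a determination condition is imposed.
      { inp := fun S => {k | ∃ i ∈ A.str.inp S, k = T2Quotient.mk ∘ i}
        out := fun T => {o | Continuous o ∧ o ∘ T2Quotient.mk ∈ A.str.out T}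
        inp_mor := by
          rintro S _ ⟨i, hi, rfl⟩
          have h1 : Continuous i := A.str.inp_mor S hi
          exact (T2Quotient.continuous_mk A.carrier).comp h1
        out_mor := fun _ _ ho => ho.1
        inp_comp := by
          rintro S T f _ hf ⟨i, hi, rfl⟩
          exact ⟨i ∘ f, A.str.inp_comp hf hi, rfl⟩
        out_comp := fun hf ho => ⟨hf.continuous.comp ho.1, A.str.out_comp hf ho.2⟩
        compat := by
          rintro S T _ o ⟨i, hi, rfl⟩ ho
          exact A.str.compat hi ho.2 }
    prop := by
      refine ⟨inTerm_of_const (line_subset_closedConvex rfl) fun S y => ?_, fun T o ho h => ?_⟩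
      · obtain ⟨x, rfl⟩ := T2Quotient.surjective_mk A.carrier y
        have h1 : Continuous fun _ : pointTest => x := continuous_const
        exact ⟨fun _ => x, A.prop.1.const_mem pointTest_mem_closedConvex S h1, rfl⟩
      · have h1 : Continuous o := ho
        have h2 : Continuous (o ∘ T2Quotient.mk) := h1.comp (T2Quotient.continuous_mk A.carrier)
        exact ⟨h1, A.prop.2 T _ h2 fun S i hi => h S _ ⟨i, hi, rfl⟩⟩ }

/-- The morphism from the Hausdorff quotient which is determined by a morphism to a Hausdorff
space. -/
def hausdorffLift {A : Space chen1975a.{u}} {Z : Space chen1973.{u}}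
    (f : A ⟶ chen1973Inclusion.obj Z) : hausdorffQuotient A ⟶ Z :=
  ⟨@T2Quotient.lift A.carrier Z.carrier A.base Z.base.1 Z.base.2 f.toFun f.isMor.1, by
    have h1 : @Continuous A.carrier Z.carrier A.base Z.base.1 f.toFun := f.isMor.1
    have h2 := @T2Quotient.continuous_lift A.carrier Z.carrier A.base Z.base.1 Z.base.2 f.toFun h1
    refine ⟨h2, ?_, fun T o ho => ⟨?_, ?_⟩⟩
    · rintro S _ ⟨i, hi, rfl⟩
      exact f.isMor.2.1 S i hi
    · have h3 : @Continuous _ _ Z.base.1 _ o := Z.str.out_mor T ho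
      exact @Continuous.comp _ _ _ (hausdorffQuotient A).base.1 Z.base.1 _ _ _ h3 h2
    · exact f.isMor.2.2 T o ho⟩

/-- Morphisms from the Hausdorff quotient are morphisms from the original space. -/
def hausdorffQuotientEquiv (A : Space chen1975a.{u}) (Z : Space chen1973.{u}) :
    (hausdorffQuotient A ⟶ Z) ≃ (A ⟶ chen1973Inclusion.obj Z) where
  toFun g := ⟨fun x => g.toFun (@T2Quotient.mk A.carrier A.base x), by
    refine ⟨?_, fun S i hi => ?_, fun T o ho => ?_⟩
    · exact @Continuous.comp _ _ _ A.base (hausdorffQuotient A).base.1 Z.base.1 _ _ g.isMor.1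
        (@T2Quotient.continuous_mk A.carrier A.base)
    · exact g.isMor.2.1 S _ ⟨i, hi, rfl⟩
    · exact (g.isMor.2.2 T o ho).2⟩
  invFun f := hausdorffLift f
  left_inv g := Space.Hom.ext (funext fun y => by
    obtain ⟨x, rfl⟩ := @T2Quotient.surjective_mk A.carrier A.base y
    rfl)
  right_inv f := rfl

theorem isRightAdjoint_chen1973Inclusion : chen1973Inclusion.{u}.IsRightAdjoint :=
  ⟨_, ⟨Adjunction.adjunctionOfEquivLeft hausdorffQuotientEquiv fun _ _ _ _ _ => rfl⟩⟩

theorem chen_main :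
    ∃ (incK : FibreFunctor chen1975b.{u} chen1975a.{u})
      (extK : FibreFunctor smith.{u} chen1975b.{u}),
      chen1973Inclusion.{u}.Full ∧ chen1973Inclusion.{u}.Faithful ∧
      chen1973Inclusion.{u}.IsRightAdjoint ∧
      incK.IsInclusion ∧ incK.functor.Full ∧ incK.functor.Faithful ∧
      incK.functor.IsRightAdjoint ∧
      extK.IsJoinExtension line_subset_closedConvex ∧
      extK.functor.Full ∧ extK.functor.Faithful ∧ extK.functor.IsRightAdjoint := by
  have hB := isRegular_topologicalSpaces.{u}
  have hd := curveDetermined_of_closedConvex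
  let incK : FibreFunctor chen1975b.{u} chen1975a.{u} :=
    FibreFunctor.inclusion _ _ chen1975b_chen1975a
  let ext : FibreFunctor smith.{u}
      (InSat ⊓ OutSat : Condition topologicalSpaces closedConvexTests) :=
    lineExtensionFunctor hB line_subset_closedConvex hd
  let res : FibreFunctor (InSat ⊓ OutSat : Condition topologicalSpaces closedConvexTests)
      smith.{u} := FibreFunctor.restriction _ _ line_subset_closedConvex
    (restrict_line_satisfies _ hd)
  let incS : FibreFunctor (InSat ⊓ OutSat : Condition topologicalSpaces.{u} closedConvexTests)
      chen1975b.{u} := FibreFunctor.inclusion _ _ sat_chen1975b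
  have hres ⦃X : Type u⦄ (b : topologicalSpaces.Str X) (V) : res.obj b (ext.obj b V) = V :=
    Subtype.ext (restrict_lineExtension hB line_subset_closedConvex hd V.1 V.2)
  have : ext.functor.Full := ext.full_of_leftInverse res hres
  have : incS.functor.Full := FibreFunctor.full_inclusion _ _ _
  -- The left adjoint keeps the functionals to the line and takes as curves all continuous maps that
  -- are smooth along them.
  let L : FibreFunctor chen1975b.{u} smith.{u} :=
    (FibreFunctor.restriction chen1975b OutSat line_subset_closedConvex
      outSat_restrict_line).comp (meetForcing hB OutSat fun _ _ _ h => h)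
  refine ⟨incK, ext.comp incS, ⟨fun g => ⟨⟨g.toFun, g.isMor⟩, rfl⟩⟩, ⟨fun {A A' f g} h => ?_⟩,
    isRightAdjoint_chen1973Inclusion, fun _ _ _ => rfl, FibreFunctor.full_inclusion _ _ _,
    incK.faithful, ⟨_, ⟨FibreFunctor.adjunction determinedHullFunctor incK
      (fun _ _ V => le_determinedHull V) fun X b W => ?_⟩⟩, fun X b V => ⟨fun W hW => ?_, ?_⟩,
    inferInstanceAs (ext.functor ⋙ incS.functor).Full, (ext.comp incS).faithful,
    ⟨_, ⟨FibreFunctor.adjunction L (ext.comp incS) (fun X b W => ?_) fun X b V => ?_⟩⟩⟩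
  · have h1 : (chen1973Inclusion.map f).toFun = (chen1973Inclusion.map g).toFun := by rw [h]
    exact Space.Hom.ext h1
  · exact VirtualStr.le_of_subset
      (fun S i hi => (mem_inp_determinedHull _).1 hi W.1 W.2 le_rfl) fun _ => subset_rfl
  · have h1 (S i) (hi : i ∈ W.1.inp S) : i ∈ (lineExtension hB hd V.1 V.2.1).inp S :=
      ⟨W.1.inp_mor S hi, fun L o ho => W.1.compat hi (hW.2 L ho)⟩
    exact VirtualStr.le_of_subset h1 fun T o ho => W.2.2 T o ho.1 fun S i hi =>
      (lineExtension hB hd V.1 V.2.1).compat (h1 S i hi) ho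
  · exact fun W hW => hW (restrict_lineExtension hB line_subset_closedConvex hd V.1 V.2).le
  · refine VirtualStr.le_of_subset (fun S i hi => ⟨W.1.inp_mor S hi, fun T o ho =>
      W.1.compat hi ho⟩) fun T o ho => W.2.2 T o ho.1 fun S i hi => ?_
    exact hd _ S.2 fun c hc => ho.2 lineTest _ ((le_saturateInp hB
      (W.1.restrict line_subset_closedConvex)).1 lineTest
        (W.1.inp_comp (S := ⟨realLine, line_subset_closedConvex rfl⟩) hc hi))
  · have h1 : (lineExtension hB hd V.1 V.2.1).restrict line_subset_closedConvex = V.1 :=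
      restrict_lineExtension hB line_subset_closedConvex hd V.1 V.2
    change saturateInp hB ((lineExtension hB hd V.1 V.2.1).restrict line_subset_closedConvex) ≤ V.1
    rw [h1]
    exact VirtualStr.le_of_subset (fun S i hi => V.2.1 S i hi.1 hi.2) fun _ => subset_rfl

end

end SmoothSpaces

theorem mainTheorem10 :
    -- Frölicher spaces, Souriau spaces and Chen spaces (over sets).
    (∃ (resF : FibreFunctor frolicherOpen.{u} frolicher.{u})
      (extF : FibreFunctor frolicher.{u} frolicherOpen.{u})
      (resD : FibreFunctor souriau.{u} souriauConvex.{u})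
      (extD : FibreFunctor souriauConvex.{u} souriau.{u})
      (incF : FibreFunctor frolicherOpen.{u} souriau.{u})
      (meetF : FibreFunctor souriau.{u} frolicherOpen.{u})
      (resC : FibreFunctor chen.{u} souriauConvex.{u})
      (meetC joinC : FibreFunctor souriauConvex.{u} chen.{u}),
      -- Restriction and extension are isomorphisms of categories.
      resF.IsRestrictionExtensionIso extF line_subset_open ∧
      resD.IsRestrictionExtensionIso extD Set.inter_subset_left ∧
      -- Frölicher spaces are a full reflective subcategory of Souriau spaces.
      incF.IsInclusion ∧ meetF.IsMeetForcing ∧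
      (extF.functor ⋙ incF.functor).Full ∧ (extF.functor ⋙ incF.functor).Faithful ∧
      Nonempty (meetF.functor ⋙ resF.functor ⊣ extF.functor ⋙ incF.functor) ∧
      -- Restriction from Chen spaces to Souriau spaces has both adjoints, which are embeddings.
      resC.IsRestriction Set.inter_subset_right ∧
      meetC.IsMeetExtension Set.inter_subset_right ∧
      joinC.IsJoinExtension Set.inter_subset_right ∧
      (resD.functor ⋙ meetC.functor).Full ∧ (resD.functor ⋙ meetC.functor).Faithful ∧
      (resD.functor ⋙ joinC.functor).Full ∧ (resD.functor ⋙ joinC.functor).Faithful ∧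
      Nonempty (resD.functor ⋙ meetC.functor ⊣ resC.functor ⋙ extD.functor) ∧
      Nonempty (resC.functor ⋙ extD.functor ⊣ resD.functor ⋙ joinC.functor)) ∧
    -- Smith spaces and Sikorski spaces (over topological spaces).
    (∃ (resS : FibreFunctor smithEuclidean.{u} smith.{u})
      (extS : FibreFunctor smith.{u} smithEuclidean.{u})
      (incS : FibreFunctor smithEuclidean.{u} sikorski.{u})
      (joinS : FibreFunctor sikorski.{u} smithEuclidean.{u}),
      resS.IsRestrictionExtensionIso extS line_subset_euclidean ∧
      -- Smith spaces are a full coreflective subcategory of Sikorski spaces.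
      incS.IsInclusion ∧ joinS.IsJoinForcing ∧
      (extS.functor ⋙ incS.functor).Full ∧ (extS.functor ⋙ incS.functor).Faithful ∧
      Nonempty (extS.functor ⋙ incS.functor ⊣ joinS.functor ⋙ resS.functor)) ∧
    -- The two embeddings of Frölicher spaces in Smith spaces, with their common left inverse.
    (frolicherToSmithCurvaceous.{u}.Full ∧ frolicherToSmithCurvaceous.{u}.Faithful ∧
      frolicherToSmithCurvaceous.{u} ⋙ smithToFrolicher = 𝟭 (Space frolicher.{u}) ∧
      frolicherToSmithFunctional.{u}.Full ∧ frolicherToSmithFunctional.{u}.Faithful ∧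
      frolicherToSmithFunctional.{u} ⋙ smithToFrolicher = 𝟭 (Space frolicher.{u})) ∧
    -- The three earlier categories of Chen spaces.
    (∃ (incK : FibreFunctor chen1975b.{u} chen1975a.{u})
      (extK : FibreFunctor smith.{u} chen1975b.{u}),
      chen1973Inclusion.{u}.Full ∧ chen1973Inclusion.{u}.Faithful ∧
      chen1973Inclusion.{u}.IsRightAdjoint ∧
      incK.IsInclusion ∧ incK.functor.Full ∧ incK.functor.Faithful ∧
      incK.functor.IsRightAdjoint ∧
      extK.IsJoinExtension line_subset_closedConvex ∧
      extK.functor.Full ∧ extK.functor.Faithful ∧ extK.functor.IsRightAdjoint) :=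
  ⟨frolicher_souriau_chen_main, smith_sikorski_main, frolicher_smith_main, chen_main⟩
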